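/- Let $n\ge 1$ and let $x\in\mathbb R^p$ and $v\in\mathbb R^n$ be zero-mean random vectors with finite second moments that are uncorrelated with each other, with covariance matrices $K_x=\mathbb E[xx^{\mathrm T}]$ and $K_v=\mathbb E[vv^{\mathrm T}]$; otherwise their joint distribution is arbitrary. Let $x_S$ be the subvector of $x$ with entries in a fixed nonempty index set of size $p_S$, let $x_C$ be the subvector of the remaining $p_C=p-p_S\ge 0$ entries, and let $K_{x_S}$, $K_{x_C}$ be their covariance matrices. For $A\in\mathbb R^{n\times p}$ let $A_S\in\mathbb R^{n\times p_S}$ be the submatrix of the columns corresponding to $x_S$, and let $y=Ax+v$. Write $M^+$ for the Moore--Penrose pseudoinverse of $M$. The partial LMMSE estimator of $x_S$, which is based on the assumed model $y=A_Sx_S+z$ with assumed covariance matrices $\hat K_{x_S}$ of $x_S$ and $\hat K_z$ of the noise $z$, is $\hat x_S=W_Sy$ with \[ W_S=\hat K_{x_S}A_S^{\mathrm T}\bigl(A_S\hat K_{x_S}A_S^{\mathrm T}+\hat K_z\bigr)^+ . \] For given $A$ its mean squared error is $J_S(W_S)=\mathbb E_{x,v}\bigl[\|x_S-W_Sy\|^2\bigr]$.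 Let now $A$ be a random matrix whose rows are i.i.d. $\mathcal N(0,I_p)$, and let $\varepsilon_S(p_S,n)=\mathbb E_A[J_S(W_S)]\in[0,\infty]$ be the expected MSE over the distribution of $A$. **Theorem 1.** Take $\hat K_{x_S}=I_{p_S}$ and $\hat K_z=0$. Then $W_S=A_S^+$ for every $A$, and \[ \varepsilon_S(p_S,n)=\operatorname{tr}(K_{x_S})\Bigl(1-\frac{\min\{p_S,n\}}{p_S}\Bigr)+\gamma\Bigl(\operatorname{tr}(K_{x_C})+\frac1n\operatorname{tr}(K_v)\Bigr), \] where \[ \gamma=\begin{cases}\dfrac{p_S}{n-p_S-1}&\text{if }p_S<n-1,\\[1ex]\dfrac{n}{p_S-n-1}&\text{if }p_S>n+1,\\[1ex]+\infty&\text{otherwise,}\end{cases} \] with the convention $\infty\cdot 0=0$. In particular, $\varepsilon_S(p_S,n)$ does not depend on the cross-covariance between $x_S$ and $x_C$, and it depends on $K_v$ only through its trace. -/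

import Mathlib

open MeasureTheory ProbabilityTheory
open scoped ENNReal Matrix

noncomputable section

namespace MismatchedLMMSE

/-- `B` is a Moore-Penrose pseudoinverse of the real matrix `A` (the four Penrose conditions). -/
structure IsMoorePenrose {m n : Type*} [Fintype m] [Fintype n]
    (A : Matrix m n ℝ) (B : Matrix n m ℝ) : Prop where
  mul_mul_self : A * B * A = A
  mul_mul_inv : B * A * B = B
  symm_left : (A * B)ᵀ = A * B
  symm_right : (B * A)ᵀ = B * A

theorem IsMoorePenrose.unique {m n : Type*} [Fintype m] [Fintype n]
    {A : Matrix m n ℝ} {B C : Matrix n m ℝ}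
    (hB : IsMoorePenrose A B) (hC : IsMoorePenrose A C) : B = C := by
  have h1 : A * B = A * C := by
    calc A * B = (A * B)ᵀ := hB.symm_left.symm
      _ = ((A * C) * (A * B))ᵀ := by
          rw [← Matrix.mul_assoc, hC.mul_mul_self]
      _ = (A * B) * (A * C) := by rw [Matrix.transpose_mul, hB.symm_left, hC.symm_left]
      _ = A * C := by rw [← Matrix.mul_assoc, hB.mul_mul_self]
  have h2 : B * A = C * A := by
    calc B * A = (B * A)ᵀ := hB.symm_right.symm
      _ = ((B * A) * (C * A))ᵀ := by
          rw [Matrix.mul_assoc B, ← Matrix.mul_assoc A C A, hC.mul_mul_self]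
      _ = (C * A) * (B * A) := by rw [Matrix.transpose_mul, hB.symm_right, hC.symm_right]
      _ = C * A := by rw [Matrix.mul_assoc C, ← Matrix.mul_assoc A B A, hB.mul_mul_self]
  calc B = B * A * B := hB.mul_mul_inv.symm
    _ = C * A * B := by rw [h2]
    _ = C * A * C := by rw [Matrix.mul_assoc, h1, ← Matrix.mul_assoc]
    _ = C := hC.mul_mul_inv

theorem exists_isMoorePenrose {m n : Type*} [Fintype m] [Fintype n]
    (A : Matrix m n ℝ) : ∃ B, IsMoorePenrose A B := by
  classical
  have hH : (Aᵀ * A).IsHermitian := by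
    have := Matrix.isHermitian_conjTranspose_mul_self A
    rwa [Matrix.conjTranspose_eq_transpose_of_trivial] at this
  obtain ⟨U, d, hU, hUd⟩ : ∃ (U : Matrix n n ℝ) (d : n → ℝ),
      Uᵀ * U = 1 ∧ Aᵀ * A = U * Matrix.diagonal d * Uᵀ := by
    refine ⟨hH.eigenvectorUnitary, hH.eigenvalues, ?_, ?_⟩
    · have := Unitary.coe_star_mul_self hH.eigenvectorUnitary
      rwa [Matrix.star_eq_conjTranspose, Matrix.conjTranspose_eq_transpose_of_trivial] at this
    · have := hH.spectral_theorem
      rw [Unitary.conjStarAlgAut_apply, Matrix.star_eq_conjTranspose,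
        Matrix.conjTranspose_eq_transpose_of_trivial] at this
      exact this
  set G : Matrix n n ℝ := U * Matrix.diagonal (fun i => (d i)⁻¹) * Uᵀ with hG
  have key : ∀ a b : n → ℝ, (U * Matrix.diagonal a * Uᵀ) * (U * Matrix.diagonal b * Uᵀ)
      = U * Matrix.diagonal (fun i => a i * b i) * Uᵀ := by
    intro a b
    calc (U * Matrix.diagonal a * Uᵀ) * (U * Matrix.diagonal b * Uᵀ)
        = U * Matrix.diagonal a * (Uᵀ * U) * Matrix.diagonal b * Uᵀ := by
          simp only [Matrix.mul_assoc]
      _ = _ := by rw [hU, Matrix.mul_one, Matrix.mul_assoc U, Matrix.diagonal_mul_diagonal]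
  have hsymm : ∀ a : n → ℝ, (U * Matrix.diagonal a * Uᵀ)ᵀ = U * Matrix.diagonal a * Uᵀ := by
    intro a
    simp [Matrix.transpose_mul, Matrix.mul_assoc]
  have hGt : Gᵀ = G := hsymm _
  have hHGH : (Aᵀ * A) * G * (Aᵀ * A) = Aᵀ * A := by
    rw [hUd, hG, key, key]
    congr; funext i
    by_cases h : d i = 0 <;> simp [h]
  have hGHG : G * (Aᵀ * A) * G = G := by
    rw [hUd, hG, key, key]
    congr; funext i
    by_cases h : d i = 0 <;> simp [h]
  have hGHt : (G * (Aᵀ * A))ᵀ = G * (Aᵀ * A) := by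
    rw [hUd, hG, key]; exact hsymm _
  have hAGH : A * G * (Aᵀ * A) = A := by
    have h0 : (A * G * (Aᵀ * A) - A)ᵀ * (A * G * (Aᵀ * A) - A) = 0 := by
      have e1 : (A * G * (Aᵀ * A) - A)ᵀ = (Aᵀ * A) * G * Aᵀ - Aᵀ := by
        simp [Matrix.transpose_sub, Matrix.transpose_mul, hGt, Matrix.mul_assoc]
      have e2 : Aᵀ * (A * G * (Aᵀ * A) - A) = 0 := by
        rw [Matrix.mul_sub]
        have : Aᵀ * (A * G * (Aᵀ * A)) = (Aᵀ * A) * G * (Aᵀ * A) := by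
          simp only [Matrix.mul_assoc]
        rw [this, hHGH, sub_self]
      rw [e1, Matrix.sub_mul, Matrix.mul_assoc _ Aᵀ, e2, Matrix.mul_zero, sub_zero]
    rw [← Matrix.conjTranspose_eq_transpose_of_trivial, Matrix.conjTranspose_mul_self_eq_zero] at h0
    exact sub_eq_zero.mp h0
  refine ⟨G * Aᵀ, ?_, ?_, ?_, ?_⟩
  · calc A * (G * Aᵀ) * A = A * G * (Aᵀ * A) := by simp only [Matrix.mul_assoc]
      _ = A := hAGH
  · calc G * Aᵀ * A * (G * Aᵀ) = G * (Aᵀ * A) * G * Aᵀ := by simp only [Matrix.mul_assoc]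
      _ = G * Aᵀ := by rw [hGHG]
  · simp [Matrix.transpose_mul, hGt, Matrix.mul_assoc]
  · rw [Matrix.mul_assoc]; exact hGHt

/-- The Moore-Penrose pseudoinverse `A⁺` of a real matrix. -/
def pinv {m n : Type*} [Fintype m] [Fintype n] (A : Matrix m n ℝ) : Matrix n m ℝ :=
  (exists_isMoorePenrose A).choose

theorem isMoorePenrose_pinv {m n : Type*} [Fintype m] [Fintype n] (A : Matrix m n ℝ) :
    IsMoorePenrose A (pinv A) :=
  (exists_isMoorePenrose A).choose_spec

/-- The matrix of the columns of `A` with indices in `S`. -/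
def colSubmatrix {n p : ℕ} (A : Matrix (Fin n) (Fin p) ℝ) (S : Finset (Fin p)) :
    Matrix (Fin n) S ℝ :=
  A.submatrix id Subtype.val

/-- The subvector of `x` of the entries with indices in `S`. -/
def subvector {p : ℕ} (x : EuclideanSpace ℝ (Fin p)) (S : Finset (Fin p)) :
    EuclideanSpace ℝ S :=
  WithLp.toLp 2 fun s => x s

/-- The covariance matrix `K_{zw} = E[(z - E z)(w - E w)ᵀ]` of two random vectors. -/
def covarianceMatrix {Ω : Type*} [MeasurableSpace Ω] {ι κ : Type*}
    (z : Ω → EuclideanSpace ℝ ι) (w : Ω → EuclideanSpace ℝ κ) (P : Measure Ω) : Matrix ι κ ℝ :=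
  Matrix.of fun i j => cov[fun ω => z ω i, fun ω => w ω j; P]

/-- The output `y = A x + v` of the underlying linear system. -/
def output {n p : ℕ} (A : Matrix (Fin n) (Fin p) ℝ) (x : EuclideanSpace ℝ (Fin p))
    (v : EuclideanSpace ℝ (Fin n)) : EuclideanSpace ℝ (Fin n) :=
  WithLp.toLp 2 (A *ᵥ x.ofLp + v.ofLp)

/-- The LMMSE estimator `W_S = K̂_{x_S} A_Sᵀ (A_S K̂_{x_S} A_Sᵀ + K̂_z)⁺` based on the assumed partial
model `y = A_S x_S + z`, with assumed covariance matrices `KxS` of `x_S` and `Kz` of `z`. -/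
def partialLMMSE {n p : ℕ} (S : Finset (Fin p)) (KxS : Matrix S S ℝ)
    (Kz : Matrix (Fin n) (Fin n) ℝ) (A : Matrix (Fin n) (Fin p) ℝ) : Matrix S (Fin n) ℝ :=
  KxS * (colSubmatrix A S)ᵀ * pinv (colSubmatrix A S * KxS * (colSubmatrix A S)ᵀ + Kz)

/-- The MSE `J_S(W) = E ‖x_S - W y‖²` of the linear estimate `W y` of `x_S`, for a fixed regressor
matrix `A`, where `y = A x + v`. -/
def mse {Ω : Type*} [MeasurableSpace Ω] {n p : ℕ} (P : Measure Ω)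
    (x : Ω → EuclideanSpace ℝ (Fin p)) (v : Ω → EuclideanSpace ℝ (Fin n)) (S : Finset (Fin p))
    (A : Matrix (Fin n) (Fin p) ℝ) (W : Matrix S (Fin n) ℝ) : ℝ≥0∞ :=
  ∫⁻ ω, ENNReal.ofReal
    (‖subvector (x ω) S - WithLp.toLp 2 (W *ᵥ (output A (x ω) (v ω)).ofLp)‖ ^ 2) ∂P

/-- The matrix with rows `a 0, …, a (n - 1)`. -/
def rowMatrix {n p : ℕ} (a : Fin n → EuclideanSpace ℝ (Fin p)) : Matrix (Fin n) (Fin p) ℝ :=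
  Matrix.of fun i j => a i j

/-- The expected MSE `ε_S = E_A [J_S(W_S)]` of the partial LMMSE estimator over the random matrix
`A` with rows `a i`. -/
def expectedMSE {Ω Ω' : Type*} [MeasurableSpace Ω] [MeasurableSpace Ω'] {n p : ℕ}
    (P : Measure Ω) (Q : Measure Ω') (x : Ω → EuclideanSpace ℝ (Fin p))
    (v : Ω → EuclideanSpace ℝ (Fin n)) (a : Fin n → Ω' → EuclideanSpace ℝ (Fin p))
    (S : Finset (Fin p)) (KxS : Matrix S S ℝ) (Kz : Matrix (Fin n) (Fin n) ℝ) : ℝ≥0∞ :=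
  ∫⁻ ω', mse P x v S (rowMatrix fun i => a i ω')
    (partialLMMSE S KxS Kz (rowMatrix fun i => a i ω')) ∂Q

/-- The factor `γ`. -/
def gammaFactor (pS n : ℕ) : ℝ≥0∞ :=
  if pS + 1 < n then ENNReal.ofReal ((pS : ℝ) / ((n : ℝ) - (pS : ℝ) - 1))
  else if n + 1 < pS then ENNReal.ofReal ((n : ℝ) / ((pS : ℝ) - (n : ℝ) - 1))
  else ∞

end MismatchedLMMSE

end

open MismatchedLMMSE

/-! With `A = A_S`, `B = A_C`, the error of the pseudoinverse estimator is `(1 - A⁺A) x_S - A⁺ v -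
A⁺ B x_C`. All integrals are of nonnegative functions, so Tonelli allows `x` and `v` to be frozen
while the regressors are averaged, and infinite values need no separate treatment. The block `B` is
independent of `A` and centered, so averaging it removes the cross terms with `A⁺ B x_C` and leaves
`‖x_C‖² ‖A⁺‖_F²`. The other two terms are orthogonal pointwise, since `1 - A⁺A` projects onto the
kernel of `A` and `A⁺ v` lies in its row space (`dotProduct_pinv_orthogonal`). The law of `A` is
invariant under rotations on either side. A rotation-invariant quadratic function of a vector is its
squared norm times an average over the basis (`eq_mul_sum_of_orthogonal_invariant`). Hence `‖(1 -
A⁺A) x_S‖²` averages to `‖x_S‖² (1 - rank/p_S)`, with rank `min p_S n` almost surely, and `‖A⁺ v‖²`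
to `‖v‖²/n` times `E ‖A⁺‖_F²`. The last expectation is `γ`. After transposing if necessary, `‖A⁺‖_F²
= tr (A Aᵀ)⁻¹`, and a diagonal entry of an inverse Gram matrix is the inverse squared distance of
one row to the span of the others (`inv_gram_apply_self`). For `m` Gaussian rows in dimension `d ≥
m` this squared distance is chi-squared with `d + 1 - m` degrees of freedom, and `E[1/χ²_k]` is
`1/(k-2)` for `k > 2` and infinite otherwise. -/

namespace MismatchedLMMSE

/-! ### Inverse moments of chi-squared variables. -/

section InverseMoment

/-- The inverse moment `E[1/χ²_k]` of a chi-squared random variable with `k ≥ 1` degrees of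
freedom. -/
noncomputable def chiSqInvMoment (k : ℕ) : ℝ≥0∞ :=
  if 2 < k then ENNReal.ofReal (1 / ((k : ℝ) - 2)) else ∞

theorem integral_exp_neg_mul_sq_gaussianReal {t : ℝ} (ht : 0 ≤ t) :
    ∫ x, Real.exp (-t * x ^ 2) ∂(gaussianReal 0 1) = (1 + 2 * t) ^ (-(1 / 2) : ℝ) := by
  have hpos : 0 < 1 + 2 * t := by linarith
  rw [integral_gaussianReal_eq_integral_smul one_ne_zero]
  have h : ∀ x : ℝ, gaussianPDFReal 0 1 x • Real.exp (-t * x ^ 2)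
      = (√(2 * Real.pi))⁻¹ * Real.exp (-((1 + 2 * t) / 2) * x ^ 2) := by
    intro x
    rw [gaussianPDFReal, smul_eq_mul, mul_assoc, ← Real.exp_add]
    simp only [NNReal.coe_one, mul_one, sub_zero]
    congr 2
    ring
  simp_rw [h]
  rw [integral_const_mul, integral_gaussian, ← Real.sqrt_inv, ← Real.sqrt_mul (by positivity),
    Real.rpow_neg hpos.le, ← Real.sqrt_eq_rpow, ← Real.sqrt_inv]
  congr 1
  field_simp

/-- Writing `1/s` as a Laplace integral reduces inverse moments to Laplace transforms. At `s = 0`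
both sides are `∞`, so the origin need not be excluded later. -/
theorem lintegral_exp_neg_mul_Ioi {s : ℝ} (hs : 0 ≤ s) :
    ∫⁻ t in Set.Ioi (0 : ℝ), ENNReal.ofReal (Real.exp (-t * s)) = (ENNReal.ofReal s)⁻¹ := by
  rcases hs.eq_or_lt with rfl | hs
  · simp
  · have h1 : ∀ t : ℝ, -t * s = (-s) * t := fun t => by ring
    simp_rw [h1]
    rw [← ofReal_integral_eq_lintegral_ofReal (integrableOn_exp_mul_Ioi (by linarith) 0)
      (ae_of_all _ fun t => (Real.exp_pos _).le), integral_exp_mul_Ioi (by linarith),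
      ← ENNReal.ofReal_inv_of_pos hs]
    congr 1
    simp

/-- Since `1 + 2t = 2 (t + 1/2)`, this is a power integral over `(1/2, ∞)`, which converges exactly
when `k/2 > 1`. -/
theorem lintegral_one_add_two_mul_rpow {k : ℕ} :
    ∫⁻ t in Set.Ioi (0 : ℝ), ENNReal.ofReal ((1 + 2 * t) ^ (-(k / 2) : ℝ)) = chiSqInvMoment k := by
  have hshift : ∫⁻ t in Set.Ioi (0 : ℝ), ENNReal.ofReal ((1 + 2 * t) ^ (-(k / 2) : ℝ))
      = ENNReal.ofReal (2 ^ (-(k / 2) : ℝ))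
        * ∫⁻ t in Set.Ioi (1 / 2 : ℝ), ENNReal.ofReal (t ^ (-(k / 2) : ℝ)) := by
    have h1 : MeasurePreserving (fun t : ℝ => t + 1 / 2) volume volume :=
      measurePreserving_add_right volume _
    have h2 := h1.setLIntegral_comp_preimage_emb (measurableEmbedding_addRight _)
      (fun t => ENNReal.ofReal (t ^ (-(k / 2) : ℝ))) (Set.Ioi (1 / 2))
    rw [← h2, ← lintegral_const_mul _ (by fun_prop)]
    have h3 : (fun t : ℝ => t + 1 / 2) ⁻¹' Set.Ioi (1 / 2) = Set.Ioi 0 := by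
      ext t; simp
    rw [h3]
    refine setLIntegral_congr_fun measurableSet_Ioi fun t ht => ?_
    have ht : 0 < t := ht
    rw [← ENNReal.ofReal_mul (by positivity), ← Real.mul_rpow (by positivity) (by positivity)]
    congr 2
    ring
  rw [hshift, chiSqInvMoment]
  split_ifs with hk
  · have hk' : (2 : ℝ) < k := by exact_mod_cast hk
    have hlt : -(k / 2 : ℝ) < -1 := by linarith
    rw [← ofReal_integral_eq_lintegral_ofReal (integrableOn_Ioi_rpow_of_lt hlt (by norm_num))
      ((ae_restrict_iff' measurableSet_Ioi).2 (ae_of_all _ fun t ht => by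
        have : (0 : ℝ) < t := lt_trans (by norm_num) ht
        positivity)),
      integral_Ioi_rpow_of_lt hlt (by norm_num), ← ENNReal.ofReal_mul (by positivity)]
    congr 1
    have e1 : (1 / 2 : ℝ) ^ (-(k / 2 : ℝ) + 1) = 2 ^ (k / 2 : ℝ) / 2 := by
      rw [Real.rpow_add (by norm_num), Real.rpow_one, one_div, Real.inv_rpow (by norm_num),
        Real.rpow_neg (by norm_num)]
      field_simp
    rw [e1, Real.rpow_neg (by norm_num)]
    have h0 : (2 : ℝ) ^ (k / 2 : ℝ) ≠ 0 := by positivity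
    have h4 : (k : ℝ) - 2 ≠ 0 := by linarith
    have h5 : -(k / 2 : ℝ) + 1 ≠ 0 := by linarith
    have h6 : (-(k / 2 : ℝ) + 1) = -((k - 2) / 2) := by ring
    rw [h6]
    field_simp
  · have hk' : (k : ℝ) ≤ 2 := by exact_mod_cast not_lt.1 hk
    have : ∫⁻ t in Set.Ioi (1 / 2 : ℝ), ENNReal.ofReal (t ^ (-(k / 2) : ℝ)) = ∞ := by
      by_contra hne
      have hint : IntegrableOn (fun t : ℝ => t ^ (-(k / 2) : ℝ)) (Set.Ioi (1 / 2)) := by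
        refine ⟨by fun_prop, ?_⟩
        rw [hasFiniteIntegral_iff_ofReal ((ae_restrict_iff' measurableSet_Ioi).2
          (ae_of_all _ fun t ht => by
            have : (0 : ℝ) < t := lt_trans (by norm_num) ht
            positivity))]
        exact lt_top_iff_ne_top.2 hne
      rw [integrableOn_Ioi_rpow_iff (by norm_num)] at hint
      linarith
    rw [this, ENNReal.mul_top]
    simp only [ne_eq, ENNReal.ofReal_eq_zero, not_le]
    positivity

variable {E : Type*} [NormedAddCommGroup E] [InnerProductSpace ℝ E] [FiniteDimensional ℝ E]
  [MeasurableSpace E] [BorelSpace E]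

/-- Coordinates in an orthonormal basis are independent, so the integral factors into
one-dimensional Laplace transforms. -/
theorem lintegral_exp_neg_mul_norm_sq_stdGaussian {t : ℝ} (ht : 0 ≤ t) :
    ∫⁻ z, ENNReal.ofReal (Real.exp (-t * ‖z‖ ^ 2)) ∂(stdGaussian E)
      = ENNReal.ofReal ((1 + 2 * t) ^ (-(Module.finrank ℝ E / 2) : ℝ)) := by
  have hpos : 0 < 1 + 2 * t := by linarith
  rw [← ofReal_integral_eq_lintegral_ofReal _ (ae_of_all _ fun t => (Real.exp_pos _).le)]
  · congr 1
    rw [stdGaussian, integral_map (Measurable.aemeasurable (by fun_prop)) (by fun_prop)]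
    have h : ∀ x : Fin (Module.finrank ℝ E) → ℝ,
        Real.exp (-t * ‖∑ i, x i • stdOrthonormalBasis ℝ E i‖ ^ 2)
          = ∏ i, Real.exp (-t * x i ^ 2) := by
      intro x
      rw [← Real.exp_sum, ← Finset.mul_sum, ← (stdOrthonormalBasis ℝ E).sum_sq_norm_inner_right]
      congr 3
      ext i
      rw [(stdOrthonormalBasis ℝ E).orthonormal.inner_right_fintype]
      simp
    simp_rw [h]
    rw [integral_fintype_prod_eq_prod (f := fun _ x => Real.exp (-t * x ^ 2))]
    simp_rw [integral_exp_neg_mul_sq_gaussianReal ht]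
    rw [Finset.prod_const, ← Real.rpow_natCast, ← Real.rpow_mul hpos.le]
    congr 1
    simp
    ring
  · refine Integrable.of_bound (C := 1) (by fun_prop) (ae_of_all _ fun z => ?_)
    rw [Real.norm_eq_abs, abs_of_pos (Real.exp_pos _), Real.exp_le_one_iff]
    have := mul_nonneg ht (sq_nonneg ‖z‖)
    linarith

theorem lintegral_inv_norm_sq_stdGaussian :
    ∫⁻ z, (ENNReal.ofReal (‖z‖ ^ 2))⁻¹ ∂(stdGaussian E)
      = chiSqInvMoment (Module.finrank ℝ E) := by
  have h : ∀ z : E, (ENNReal.ofReal (‖z‖ ^ 2))⁻¹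
      = ∫⁻ t in Set.Ioi (0 : ℝ), ENNReal.ofReal (Real.exp (-t * ‖z‖ ^ 2)) := fun z =>
    (lintegral_exp_neg_mul_Ioi (sq_nonneg _)).symm
  simp_rw [h]
  rw [lintegral_lintegral_swap (by fun_prop), ← lintegral_one_add_two_mul_rpow]
  exact setLIntegral_congr_fun measurableSet_Ioi fun t ht =>
    lintegral_exp_neg_mul_norm_sq_stdGaussian (le_of_lt ht)

/-- The image of a standard Gaussian measure under a linear map whose adjoint is isometric is
standard Gaussian. -/
theorem map_stdGaussian_of_norm_adjoint {F : Type*} [NormedAddCommGroup F] [InnerProductSpace ℝ F]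
    [FiniteDimensional ℝ F] [MeasurableSpace F] [BorelSpace F] (f : E →L[ℝ] F)
    (hf : ∀ t, ‖f.adjoint t‖ = ‖t‖) : (stdGaussian E).map f = stdGaussian F := by
  have : IsProbabilityMeasure ((stdGaussian E).map f) :=
    Measure.isProbabilityMeasure_map (by fun_prop)
  apply Measure.ext_of_charFun
  ext t
  -- The characteristic function of the image at `t` is that of `stdGaussian E` at `f.adjoint t`,
  -- and it depends only on the norm.
  rw [charFun_stdGaussian, charFun_apply, integral_map (by fun_prop) (by fun_prop), ← hf t,
    ← charFun_stdGaussian, charFun_apply]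
  simp_rw [ContinuousLinearMap.adjoint_inner_right]

theorem map_orthogonalProjection_stdGaussian (V : Submodule ℝ E) :
    (stdGaussian E).map V.orthogonalProjectionOnto = stdGaussian V := by
  refine map_stdGaussian_of_norm_adjoint _ fun t => ?_
  rw [Submodule.adjoint_orthogonalProjectionOnto]
  simp

end InverseMoment

/-! ### Gram matrices of independent Gaussian vectors. -/

section Gram

/-- Resampling one coordinate leaves the integral unchanged; this is how all vectors but one are
held fixed below. -/
theorem lintegral_pi_eq_lintegral_update {ι : Type*} [Fintype ι] [DecidableEq ι] {X : ι → Type*}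
    [∀ i, MeasurableSpace (X i)] (μ : ∀ i, Measure (X i)) [∀ i, IsProbabilityMeasure (μ i)]
    {f : (∀ i, X i) → ℝ≥0∞} (hf : Measurable f) (j : ι) :
    ∫⁻ z, f z ∂(Measure.pi μ)
      = ∫⁻ z, ∫⁻ y, f (Function.update z j y) ∂(μ j) ∂(Measure.pi μ) := by
  have hg : Measurable fun z => ∫⁻ y, f (Function.update z j y) ∂(μ j) := by
    rw [← lmarginal_singleton f j]
    exact hf.lmarginal μ
  have z₀ : ∀ i, X i := fun i => (nonempty_of_isProbabilityMeasure (μ i)).some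
  rw [lintegral_eq_lmarginal_univ z₀, lmarginal_erase' f hf (Finset.mem_univ j),
    lintegral_eq_lmarginal_univ z₀, lmarginal_erase' _ hg (Finset.mem_univ j)]
  simp

variable {E : Type*} [NormedAddCommGroup E] [InnerProductSpace ℝ E]

theorem exists_sum_smul_of_mem_span_image {ι : Type*} [Fintype ι] {z : ι → E} {s : Set ι} {u : E}
    (hu : u ∈ Submodule.span ℝ (z '' s)) :
    ∃ c : ι → ℝ, (∀ i ∉ s, c i = 0) ∧ ∑ i, c i • z i = u := by
  obtain ⟨l, hl, rfl⟩ := (Finsupp.mem_span_image_iff_linearCombination ℝ).1 hu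
  refine ⟨l, fun i hi => ?_, ?_⟩
  · by_contra h
    exact hi (hl (by simpa using h))
  · rw [Finsupp.linearCombination_apply, Finsupp.sum_fintype _ _ (by simp)]

/-- The residual `w` of `z j` after projection onto the span of the others is a combination of the
`z i` with coefficient vector `d`, `d j = 1`. It is orthogonal to every other `z i`, so the Gram
matrix sends `d` to `‖w‖²` times the `j`-th basis vector; inverting and reading entry `j` gives the
claim. -/
theorem inv_gram_apply_self {ι : Type*} [Fintype ι] [DecidableEq ι] [FiniteDimensional ℝ E]
    {z : ι → E} (hz : LinearIndependent ℝ z) (j : ι) :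
    (Matrix.gram ℝ z)⁻¹ j j
      = (‖(Submodule.span ℝ (z '' {j}ᶜ))ᗮ.orthogonalProjectionOnto (z j)‖ ^ 2)⁻¹ := by
  set V := Submodule.span ℝ (z '' {j}ᶜ)
  set w : E := z j - V.starProjection (z j) with hw
  have hnorm : ‖Vᗮ.orthogonalProjectionOnto (z j)‖ = ‖w‖ := by
    rw [Submodule.orthogonalProjectionOnto_orthogonal]
    rfl
  have hwV : w ∈ Vᗮ := V.sub_starProjection_mem_orthogonal (z j)
  obtain ⟨c, hc, hcu⟩ := exists_sum_smul_of_mem_span_image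
    (V.starProjection_apply_mem (z j))
  have hcj : c j = 0 := hc j (by simp)
  set d : ι → ℝ := Pi.single j 1 - c
  have hd : ∑ i, d i • z i = w := by
    simp [d, sub_smul, Finset.sum_sub_distrib, hcu, hw, Pi.single_apply]
  have hgram : Matrix.gram ℝ z *ᵥ d = Pi.single j (‖w‖ ^ 2) := by
    ext i
    have h1 : (Matrix.gram ℝ z *ᵥ d) i = inner ℝ (z i) w := by
      rw [← hd, inner_sum]
      simp [Matrix.mulVec, dotProduct, Matrix.gram_apply, inner_smul_right, mul_comm]
    rw [h1]
    by_cases hij : i = j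
    · subst hij
      have h2 : z i = w + V.starProjection (z i) := by simp [hw]
      rw [h2, inner_add_left, real_inner_self_eq_norm_sq,
        Submodule.inner_right_of_mem_orthogonal (V.starProjection_apply_mem (z i)) hwV]
      simp
    · rw [Pi.single_eq_of_ne hij, Submodule.inner_right_of_mem_orthogonal
        (K := V) (Submodule.subset_span (Set.mem_image_of_mem z hij)) hwV]
  have hdet : IsUnit (Matrix.gram ℝ z).det :=
    (Matrix.det_gram_ne_zero_iff_linearIndependent.2 hz).isUnit
  have hinv : d = (Matrix.gram ℝ z)⁻¹ *ᵥ Pi.single j (‖w‖ ^ 2) := by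
    rw [← hgram, Matrix.mulVec_mulVec, Matrix.nonsing_inv_mul _ hdet, Matrix.one_mulVec]
  have h3 := congrFun hinv j
  rw [Matrix.mulVec_single] at h3
  simp only [d, Pi.sub_apply, Pi.single_eq_same, hcj, sub_zero] at h3
  rw [hnorm]
  have h4 : 1 = (Matrix.gram ℝ z)⁻¹ j j * ‖w‖ ^ 2 := by simpa using h3
  exact eq_inv_of_mul_eq_one_left h4.symm

theorem continuous_gram {ι : Type*} : Continuous fun z : ι → E => Matrix.gram ℝ z :=
  continuous_matrix fun i j => by
    simp only [Matrix.gram_apply]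
    fun_prop

variable [MeasurableSpace E] [BorelSpace E]

theorem measurable_inv_gram_apply {ι : Type*} [Fintype ι] [DecidableEq ι] [FiniteDimensional ℝ E]
    (i j : ι) : Measurable fun z : ι → E => (Matrix.gram ℝ z)⁻¹ i j := by
  have h : (fun z : ι → E => (Matrix.gram ℝ z)⁻¹ i j)
      = fun z => (Matrix.gram ℝ z).det⁻¹ * (Matrix.gram ℝ z).adjugate i j := by
    ext z
    rw [Matrix.inv_def, Ring.inverse_eq_inv', Matrix.smul_apply, smul_eq_mul]
  rw [h]
  have h1 : Continuous fun z : ι → E => (Matrix.gram ℝ z).det := continuous_gram.matrix_det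
  have h2 : Continuous fun z : ι → E => (Matrix.gram ℝ z).adjugate i j :=
    continuous_gram.matrix_adjugate.matrix_elem i j
  exact h1.measurable.inv.mul h2.measurable

theorem measurableSet_linearIndepOn {ι : Type*} [Finite ι] [FiniteDimensional ℝ E] (s : Finset ι) :
    MeasurableSet {z : ι → E | LinearIndepOn ℝ z (s : Set ι)} := by
  classical
  have h : {z : ι → E | LinearIndepOn ℝ z (s : Set ι)}
      = {z | (Matrix.gram ℝ fun i : s => z i).det ≠ 0} := by
    ext z
    exact (Matrix.det_gram_ne_zero_iff_linearIndependent (𝕜 := ℝ) (v := fun i : s => z i)).symm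
  rw [h]
  have h1 : Continuous fun z : ι → E => (Matrix.gram ℝ fun i : s => z i).det :=
    ((continuous_gram (E := E)).comp (g := fun z : s → E => Matrix.gram ℝ z)
      (f := fun (z : ι → E) (i : s) => z i) (by fun_prop)).matrix_det
  exact (measurableSet_singleton (0 : ℝ)).compl.preimage h1.measurable

variable [FiniteDimensional ℝ E]

/-- A proper subspace lies in the kernel of `⟨u, ·⟩` for some nonzero `u`, and this functional has a
nondegenerate Gaussian law, hence no atom at `0`. -/
theorem stdGaussian_submodule_eq_zero {V : Submodule ℝ E} (hV : V ≠ ⊤) :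
    stdGaussian E (V : Set E) = 0 := by
  obtain ⟨u, huV, hu⟩ := Submodule.exists_mem_ne_zero_of_ne_bot
    (mt V.orthogonal_eq_bot_iff.1 hV)
  have hsub : (V : Set E) ⊆ (innerSL ℝ u) ⁻¹' {0} := fun x hx => by
    simpa using Submodule.inner_left_of_mem_orthogonal hx huV
  refine measure_mono_null hsub ?_
  rw [← Measure.map_apply (by fun_prop) (measurableSet_singleton 0),
    IsGaussian.map_eq_gaussianReal]
  have : NullSingletonClass (gaussianReal ((stdGaussian E)[innerSL ℝ u])
      Var[innerSL ℝ u; stdGaussian E].toNNReal) := by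
    refine nullSingletonClass_gaussianReal ?_
    rw [variance_dual_stdGaussian, innerSL_apply_norm]
    simpa using hu
  exact measure_singleton 0

variable {ι : Type*} [Fintype ι]

/-- Fewer than `finrank ℝ E` vectors span a proper subspace, which the next Gaussian vector almost
surely avoids. -/
theorem ae_linearIndepOn_pi_stdGaussian (s : Finset ι) (hs : s.card ≤ Module.finrank ℝ E) :
    ∀ᵐ z ∂(Measure.pi fun _ : ι => stdGaussian E), LinearIndepOn ℝ z (s : Set ι) := by
  classical
  induction s using Finset.induction_on with
  | empty => exact ae_of_all _ fun z => by simp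
  | insert j s hj ih =>
    rw [Finset.card_insert_of_notMem hj] at hs
    have hm := measurableSet_linearIndepOn (E := E) (insert j s)
    rw [ae_iff, ← Set.compl_ofPred, ← lintegral_indicator_one hm.compl,
      lintegral_pi_eq_lintegral_update _ (measurable_one.indicator hm.compl) j]
    refine (lintegral_congr_ae ?_).trans lintegral_zero
    filter_upwards [ih (by omega)] with z hz
    have hV : Submodule.span ℝ (z '' (s : Set ι)) ≠ ⊤ := by
      intro h
      have h1 := finrank_span_finset_le_card (R := ℝ) (s.image z)
      rw [Set.finrank, Finset.coe_image, h, finrank_top] at h1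
      have := h1.trans Finset.card_image_le
      omega
    refine (lintegral_congr_ae ?_).trans lintegral_zero
    have hnull := measure_eq_zero_iff_ae_notMem.1 (stdGaussian_submodule_eq_zero hV)
    filter_upwards [hnull] with y hy
    rw [Set.indicator_of_notMem]
    simp only [Set.mem_compl_iff, Set.mem_ofPred_eq, not_not, Finset.coe_insert]
    rw [linearIndepOn_insert (by simpa using hj)]
    have hcongr : Set.EqOn (Function.update z j y) z (s : Set ι) := fun i hi =>
      Function.update_of_ne (by rintro rfl; exact hj (by simpa using hi)) _ _
    rw [hcongr.image_eq, Function.update_self, linearIndepOn_congr hcongr]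
    exact ⟨hz, hy⟩

theorem ae_linearIndependent_pi_stdGaussian (h : Fintype.card ι ≤ Module.finrank ℝ E) :
    ∀ᵐ z ∂(Measure.pi fun _ : ι => stdGaussian E), LinearIndependent ℝ z := by
  filter_upwards [ae_linearIndepOn_pi_stdGaussian (E := E) (Finset.univ : Finset ι)
    (by simpa using h)] with z hz
  rwa [Finset.coe_univ, linearIndepOn_univ_iff] at hz

/-- With the other vectors fixed, their span `V` almost surely has dimension one less than the
number of vectors. The projection of `z j` onto `Vᗮ` is standard Gaussian there, so the inner
integral depends only on the dimension of `Vᗮ`. -/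
theorem lintegral_inv_gram_pi_stdGaussian [DecidableEq ι]
    (h : Fintype.card ι ≤ Module.finrank ℝ E) (j : ι) :
    ∫⁻ z, ENNReal.ofReal ((Matrix.gram ℝ z)⁻¹ j j) ∂(Measure.pi fun _ : ι => stdGaussian E)
      = chiSqInvMoment (Module.finrank ℝ E + 1 - Fintype.card ι) := by
  have hpos : 0 < Fintype.card ι := Fintype.card_pos_iff.2 ⟨j⟩
  have hcard : (Finset.univ.erase j).card = Fintype.card ι - 1 := by simp
  have hcoe : ((Finset.univ.erase j : Finset ι) : Set ι) = {j}ᶜ := by ext; simp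
  rw [lintegral_pi_eq_lintegral_update _ (measurable_inv_gram_apply j j).ennreal_ofReal j]
  have key : ∀ᵐ z ∂(Measure.pi fun _ : ι => stdGaussian E),
      ∫⁻ y, ENNReal.ofReal ((Matrix.gram ℝ (Function.update z j y))⁻¹ j j) ∂(stdGaussian E)
        = chiSqInvMoment (Module.finrank ℝ E + 1 - Fintype.card ι) := by
    filter_upwards [ae_linearIndepOn_pi_stdGaussian (E := E) (Finset.univ.erase j)
      (by omega)] with z hz
    set V := Submodule.span ℝ (z '' {j}ᶜ) with hVdef
    have hdim : Module.finrank ℝ V = Fintype.card ι - 1 := by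
      have h1 := finrank_span_eq_card hz
      rw [← Set.image_eq_range z ((Finset.univ.erase j : Finset ι) : Set ι)] at h1
      rw [hVdef, ← hcoe, h1]
      simp
    have hdim' : Module.finrank ℝ Vᗮ = Module.finrank ℝ E + 1 - Fintype.card ι := by
      have := V.finrank_add_finrank_orthogonal
      omega
    have hV : V ≠ ⊤ := by
      intro hV
      rw [hV, finrank_top] at hdim
      omega
    rw [← hdim', ← lintegral_inv_norm_sq_stdGaussian, ← map_orthogonalProjection_stdGaussian,
      lintegral_map (by fun_prop) (by fun_prop)]
    refine lintegral_congr_ae ?_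
    filter_upwards [measure_eq_zero_iff_ae_notMem.1 (stdGaussian_submodule_eq_zero hV)] with y hy
    have hcongr : Set.EqOn (Function.update z j y) z {j}ᶜ := fun i hi =>
      Function.update_of_ne hi _ _
    have hins : (Set.univ : Set ι) = insert j {j}ᶜ := by ext i; simp [em]
    have hli : LinearIndependent ℝ (Function.update z j y) := by
      rw [← linearIndepOn_univ_iff, hins, linearIndepOn_insert (by simp),
        hcongr.image_eq, Function.update_self, linearIndepOn_congr hcongr, ← hcoe]
      exact ⟨hz, by rwa [hcoe]⟩
    rw [inv_gram_apply_self hli, hcongr.image_eq, Function.update_self, ENNReal.ofReal_inv_of_pos]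
    -- Nonvanishing matters: at `0` the real inverse is `0`, whereas the inverse in `ℝ≥0∞` is `∞`.
    have hne : Vᗮ.orthogonalProjectionOnto y ≠ 0 := by
      intro h0
      rw [Submodule.orthogonalProjectionOnto_orthogonal] at h0
      have h2 : y - V.starProjection y = 0 := congrArg Subtype.val h0
      exact hy (by rw [sub_eq_zero.1 h2]; exact V.starProjection_apply_mem y)
    positivity
  rw [lintegral_congr_ae key]
  simp

end Gram

/-! ### Algebra of the pseudoinverse. -/

section Pseudoinverse

theorem mul_transpose_eq_gram {m n : Type*} [Fintype n] (z : m → EuclideanSpace ℝ n) :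
    (Matrix.of fun i j => z i j) * (Matrix.of fun i j => z i j)ᵀ = Matrix.gram ℝ z := by
  ext i j
  simp [Matrix.mul_apply, Matrix.gram_apply, PiLp.inner_apply, mul_comm]

variable {m n : Type*} [Fintype m] [Fintype n]

theorem IsMoorePenrose.transpose {A : Matrix m n ℝ} {B : Matrix n m ℝ} (h : IsMoorePenrose A B) :
    IsMoorePenrose Aᵀ Bᵀ where
  mul_mul_self := by
    rw [← Matrix.transpose_mul, ← Matrix.transpose_mul, ← Matrix.mul_assoc, h.mul_mul_self]
  mul_mul_inv := by
    rw [← Matrix.transpose_mul, ← Matrix.transpose_mul, ← Matrix.mul_assoc, h.mul_mul_inv]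
  symm_left := by rw [← Matrix.transpose_mul, h.symm_right, h.symm_right]
  symm_right := by rw [← Matrix.transpose_mul, h.symm_left, h.symm_left]

theorem IsMoorePenrose.mul_transpose_orthogonal [DecidableEq n] {A : Matrix m n ℝ}
    {B : Matrix n m ℝ} (h : IsMoorePenrose A B) {O : Matrix n n ℝ} (hO : Oᵀ * O = 1) :
    IsMoorePenrose (A * Oᵀ) (O * B) := by
  have h1 : A * Oᵀ * (O * B) = A * B := by
    rw [Matrix.mul_assoc, ← Matrix.mul_assoc Oᵀ, hO, Matrix.one_mul]
  have h2 : O * B * (A * Oᵀ) = O * (B * A) * Oᵀ := by simp only [Matrix.mul_assoc]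
  refine ⟨?_, ?_, ?_, ?_⟩
  · rw [h1, ← Matrix.mul_assoc, h.mul_mul_self]
  · rw [Matrix.mul_assoc (O * B), h1, Matrix.mul_assoc O, ← Matrix.mul_assoc B, h.mul_mul_inv]
  · rw [h1, h.symm_left]
  · rw [h2, Matrix.transpose_mul, Matrix.transpose_mul, Matrix.transpose_transpose, h.symm_right,
      ← Matrix.mul_assoc]

theorem pinv_eq {A : Matrix m n ℝ} {B : Matrix n m ℝ} (h : IsMoorePenrose A B) : pinv A = B :=
  (isMoorePenrose_pinv A).unique h

theorem pinv_transpose (A : Matrix m n ℝ) : pinv Aᵀ = (pinv A)ᵀ :=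
  pinv_eq (isMoorePenrose_pinv A).transpose

theorem pinv_mul_transpose_orthogonal [DecidableEq n] (A : Matrix m n ℝ) {O : Matrix n n ℝ}
    (hO : Oᵀ * O = 1) : pinv (A * Oᵀ) = O * pinv A :=
  pinv_eq ((isMoorePenrose_pinv A).mul_transpose_orthogonal hO)

/-- `A⁺ = Aᵀ (A Aᵀ)⁺`. -/
theorem transpose_mul_pinv_mul_transpose (A : Matrix m n ℝ) :
    Aᵀ * pinv (A * Aᵀ) = pinv A := by
  set B := pinv A
  have hB : IsMoorePenrose A B := isMoorePenrose_pinv A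
  have hBA : Aᵀ * Bᵀ = B * A := by rw [← Matrix.transpose_mul, hB.symm_right]
  have hAB : Bᵀ * Aᵀ = A * B := by rw [← Matrix.transpose_mul, hB.symm_left]
  -- The pseudoinverse of `A Aᵀ` is `Bᵀ B`: its products with `A Aᵀ` on both sides equal the
  -- orthogonal projection `A B`.
  have e1 : A * Aᵀ * (Bᵀ * B) = A * B := by
    calc A * Aᵀ * (Bᵀ * B) = A * (Aᵀ * Bᵀ) * B := by simp only [Matrix.mul_assoc]
      _ = A * B * A * B := by rw [hBA]; simp only [Matrix.mul_assoc]
      _ = A * B := by rw [hB.mul_mul_self]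
  have e2 : Bᵀ * B * (A * Aᵀ) = A * B := by
    calc Bᵀ * B * (A * Aᵀ) = Bᵀ * (B * A) * Aᵀ := by simp only [Matrix.mul_assoc]
      _ = (Bᵀ * Aᵀ) * (Bᵀ * Aᵀ) := by rw [← hBA]; simp only [Matrix.mul_assoc]
      _ = A * B * A * B := by rw [hAB]; simp only [Matrix.mul_assoc]
      _ = A * B := by rw [hB.mul_mul_self]
  have h : IsMoorePenrose (A * Aᵀ) (Bᵀ * B) := by
    refine ⟨?_, ?_, ?_, ?_⟩
    · rw [e1, ← Matrix.mul_assoc, hB.mul_mul_self]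
    · calc Bᵀ * B * (A * Aᵀ) * (Bᵀ * B) = A * B * (Bᵀ * B) := by rw [e2]
        _ = Bᵀ * Aᵀ * Bᵀ * B := by rw [← hAB, Matrix.mul_assoc, Matrix.mul_assoc, Matrix.mul_assoc]
        _ = Bᵀ * B := by rw [hB.transpose.mul_mul_inv]
    · rw [e1, hB.symm_left]
    · rw [e2, hB.symm_left]
  rw [pinv_eq h, ← Matrix.mul_assoc, hBA, hB.mul_mul_inv]

section FullRank

variable {A : Matrix m n ℝ}

variable [DecidableEq m]

theorem isMoorePenrose_of_isUnit_det (hA : IsUnit (A * Aᵀ).det) :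
    IsMoorePenrose A (Aᵀ * (A * Aᵀ)⁻¹) := by
  have h1 : A * (Aᵀ * (A * Aᵀ)⁻¹) = 1 := by
    rw [← Matrix.mul_assoc, Matrix.mul_nonsing_inv _ hA]
  refine ⟨by rw [h1, Matrix.one_mul], by rw [Matrix.mul_assoc, h1, Matrix.mul_one], ?_, ?_⟩
  · rw [h1, Matrix.transpose_one]
  · simp only [Matrix.transpose_mul, Matrix.transpose_transpose, Matrix.transpose_nonsing_inv,
      Matrix.mul_assoc]

theorem mul_pinv_of_isUnit_det (hA : IsUnit (A * Aᵀ).det) : A * pinv A = 1 := by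
  rw [pinv_eq (isMoorePenrose_of_isUnit_det hA), ← Matrix.mul_assoc, Matrix.mul_nonsing_inv _ hA]

theorem transpose_pinv_mul_pinv_of_isUnit_det (hA : IsUnit (A * Aᵀ).det) :
    (pinv A)ᵀ * pinv A = (A * Aᵀ)⁻¹ := by
  rw [pinv_eq (isMoorePenrose_of_isUnit_det hA)]
  simp only [Matrix.transpose_mul, Matrix.transpose_transpose, Matrix.transpose_nonsing_inv]
  rw [Matrix.mul_assoc, ← Matrix.mul_assoc A, Matrix.mul_nonsing_inv _ hA, Matrix.mul_one]

end FullRank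

/-- The matrix `1 - A⁺A` is the orthogonal projection complementary to `A⁺A`, whose range contains
every `A⁺ y`. -/
theorem dotProduct_pinv_orthogonal [DecidableEq n] (A : Matrix m n ℝ) (x : n → ℝ) (y : m → ℝ) :
    ((1 - pinv A * A) *ᵥ x) ⬝ᵥ (pinv A *ᵥ y) = 0 := by
  have h := isMoorePenrose_pinv A
  rw [Matrix.dotProduct_mulVec, ← Matrix.mulVec_transpose, Matrix.mulVec_mulVec]
  have h1 : (pinv A)ᵀ * (1 - pinv A * A) = 0 := by
    have h2 : ((pinv A)ᵀ * (1 - pinv A * A))ᵀ = 0 := by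
      rw [Matrix.transpose_mul, Matrix.transpose_sub, h.symm_right, Matrix.transpose_one,
        Matrix.transpose_transpose, Matrix.sub_mul, h.mul_mul_inv, Matrix.one_mul, sub_self]
    rw [← Matrix.transpose_transpose ((pinv A)ᵀ * (1 - pinv A * A)), h2, Matrix.transpose_zero]
  rw [h1, Matrix.zero_mulVec, zero_dotProduct]

theorem sum_dotProduct_mulVec_single [DecidableEq n] (M : Matrix m n ℝ) :
    ∑ j, (M *ᵥ Pi.single j 1) ⬝ᵥ (M *ᵥ Pi.single j 1) = (Mᵀ * M).trace := by
  simp [Matrix.trace, Matrix.mul_apply, dotProduct]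

theorem sum_sq_eq_trace (M : Matrix m n ℝ) :
    ∑ i, ∑ j, M i j ^ 2 = (Mᵀ * M).trace := by
  rw [Finset.sum_comm]
  simp [Matrix.trace, Matrix.mul_apply, sq]

theorem trace_transpose_mul_one_sub_pinv_mul [DecidableEq n] (A : Matrix m n ℝ) :
    ((1 - pinv A * A)ᵀ * (1 - pinv A * A)).trace = Fintype.card n - (pinv A * A).trace := by
  have h := isMoorePenrose_pinv A
  rw [Matrix.transpose_sub, h.symm_right, Matrix.transpose_one, Matrix.sub_mul, Matrix.mul_sub,
    Matrix.mul_sub, Matrix.one_mul, Matrix.one_mul, Matrix.mul_one, ← Matrix.mul_assoc (pinv A * A), h.mul_mul_inv, sub_self,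
    sub_zero, Matrix.trace_sub, Matrix.trace_one]

theorem partialLMMSE_one_zero {n p : ℕ} (S : Finset (Fin p)) (A : Matrix (Fin n) (Fin p) ℝ) :
    partialLMMSE S (1 : Matrix S S ℝ) (0 : Matrix (Fin n) (Fin n) ℝ) A
      = pinv (colSubmatrix A S) := by
  rw [partialLMMSE, Matrix.one_mul, Matrix.mul_one, add_zero, transpose_mul_pinv_mul_transpose]

end Pseudoinverse

/-! ### Laws and symmetries of Gaussian matrices. -/

section GaussianMatrix

/-- The law of a vector of i.i.d. standard Gaussian entries. -/
noncomputable abbrev gaussianVector (κ : Type*) [Fintype κ] : Measure (κ → ℝ) :=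
  Measure.pi fun _ => gaussianReal 0 1

/-- The law of a matrix of i.i.d. standard Gaussian entries. -/
noncomputable abbrev gaussianMatrix (ι κ : Type*) [Fintype ι] [Fintype κ] :
    Measure (ι → κ → ℝ) :=
  Measure.pi fun _ => gaussianVector κ

variable {ι κ : Type*} [Fintype ι] [Fintype κ]

theorem measurePreserving_toLp_gaussianVector :
    MeasurePreserving (WithLp.toLp 2) (gaussianVector κ) (stdGaussian (EuclideanSpace ℝ κ)) :=
  ⟨by fun_prop, map_pi_eq_stdGaussian⟩

theorem measurePreserving_ofLp_stdGaussian :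
    MeasurePreserving WithLp.ofLp (stdGaussian (EuclideanSpace ℝ κ)) (gaussianVector κ) := by
  refine ⟨by fun_prop, ?_⟩
  rw [← map_pi_eq_stdGaussian, Measure.map_map (by fun_prop) (by fun_prop)]
  exact Measure.map_id

theorem measurePreserving_toLp_gaussianMatrix :
    MeasurePreserving (fun (z : ι → κ → ℝ) i => WithLp.toLp 2 (z i)) (gaussianMatrix ι κ)
      (Measure.pi fun _ => stdGaussian (EuclideanSpace ℝ κ)) :=
  measurePreserving_pi _ _ fun _ => measurePreserving_toLp_gaussianVector

theorem measurePreserving_pi_comp {α : Type*} [MeasurableSpace α] (μ : Measure α)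
    [IsProbabilityMeasure μ] {g : κ → ι} (hg : g.Injective) :
    MeasurePreserving (fun (z : ι → α) j => z (g j)) (Measure.pi fun _ => μ)
      (Measure.pi fun _ => μ) := by
  refine ⟨by fun_prop, ?_⟩
  have h : iIndepFun (fun i (z : ι → α) => z i) (Measure.pi fun _ => μ) :=
    iIndepFun_pi (X := fun _ x => x) fun _ => aemeasurable_id
  rw [(iIndepFun_iff_map_fun_eq_pi_map (fun _ => Measurable.aemeasurable (by fun_prop))).1
    (h.precomp hg)]
  congr
  ext1 j
  exact (measurePreserving_eval (fun _ => μ) (g j)).map_eq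

theorem measurePreserving_pi_finset_compl {α : Type*} [MeasurableSpace α] (μ : Measure α)
    [IsProbabilityMeasure μ] [DecidableEq κ] (S : Finset κ) :
    MeasurePreserving
      (fun (z : κ → α) => ((fun j : S => z j), (fun j : (Sᶜ : Finset κ) => z j)))
      (Measure.pi fun _ => μ) ((Measure.pi fun _ => μ).prod (Measure.pi fun _ => μ)) := by
  refine ⟨by fun_prop, ?_⟩
  have h : iIndepFun (fun i (z : κ → α) => z i) (Measure.pi fun _ => μ) :=
    iIndepFun_pi (X := fun _ x => x) fun _ => aemeasurable_id
  rw [(indepFun_iff_map_prod_eq_prod_map_map (Measurable.aemeasurable (by fun_prop))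
      (Measurable.aemeasurable (by fun_prop))).1
    (h.indepFun_finset S Sᶜ disjoint_compl_right fun _ => by fun_prop),
    (measurePreserving_pi_comp μ (g := fun j : S => (j : κ)) Subtype.val_injective).map_eq,
    (measurePreserving_pi_comp μ (g := fun j : (Sᶜ : Finset κ) => (j : κ))
      Subtype.val_injective).map_eq]

/-- Independence of the two column blocks is what allows `A_C` to be averaged with `A_S` fixed. -/
theorem measurePreserving_columns_gaussianMatrix [DecidableEq κ] (S : Finset κ) :
    MeasurePreserving
      (fun (z : ι → κ → ℝ) => ((fun i (j : S) => z i j), (fun i (j : (Sᶜ : Finset κ)) => z i j)))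
      (gaussianMatrix ι κ)
      ((gaussianMatrix ι S).prod (gaussianMatrix ι (Sᶜ : Finset κ))) :=
  (measurePreserving_arrowProdEquivProdArrow (S → ℝ) ((Sᶜ : Finset κ) → ℝ) ι _ _).comp
    (measurePreserving_pi (ι := ι) _ _ fun _ => measurePreserving_pi_finset_compl _ S)

theorem measurePreserving_curry_gaussianVector :
    MeasurePreserving (fun (z : ι × κ → ℝ) i j => z (i, j)) (gaussianVector (ι × κ))
      (gaussianMatrix ι κ) := by
  refine ⟨by fun_prop, ?_⟩
  have h := Measure.infinitePi_map_curry (fun (_ : ι) (_ : κ) => gaussianReal 0 1)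
  simp only [Measure.infinitePi_eq_pi] at h
  exact h

/-- Transposition only permutes the i.i.d. entries, as is seen after flattening the matrix to a
vector indexed by pairs. -/
theorem measurePreserving_swap_gaussianMatrix :
    MeasurePreserving (fun (z : ι → κ → ℝ) j i => z i j) (gaussianMatrix ι κ)
      (gaussianMatrix κ ι) := by
  refine ⟨by fun_prop, ?_⟩
  rw [← measurePreserving_curry_gaussianVector.map_eq, Measure.map_map (by fun_prop) (by fun_prop)]
  exact (measurePreserving_curry_gaussianVector.comp
    (measurePreserving_pi_comp (gaussianReal 0 1) (Prod.swap_injective (α := κ) (β := ι)))).map_eq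

theorem integral_sum_mul_add_sq_gaussianVector (c : κ → ℝ) (t : ℝ) :
    Integrable (fun z => (∑ j, c j * z j + t) ^ 2) (gaussianVector κ) ∧
      ∫ z, (∑ j, c j * z j + t) ^ 2 ∂(gaussianVector κ) = ∑ j, c j ^ 2 + t ^ 2 := by
  have hL : ∀ j : κ, MemLp (fun z : κ → ℝ => c j * z j) 2 (gaussianVector κ) := fun j =>
    (IsGaussian.memLp_two_id.comp_measurePreserving
      (measurePreserving_eval (fun _ : κ => gaussianReal 0 1) j)).const_mul _
  have hsum : MemLp (fun z : κ → ℝ => ∑ j, c j * z j) 2 (gaussianVector κ) :=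
    memLp_finsetSum _ fun j _ => hL j
  have hadd : MemLp (fun z : κ → ℝ => ∑ j, c j * z j + t) 2 (gaussianVector κ) :=
    hsum.add (memLp_const t)
  refine ⟨hadd.integrable_sq, ?_⟩
  have hint : ∀ j, ∫ z : κ → ℝ, c j * z j ∂(gaussianVector κ) = 0 := by
    intro j
    rw [integral_const_mul, integral_comp_eval (μ := fun _ : κ => gaussianReal 0 1)
      (f := fun x => x) (i := j) (by fun_prop)]
    simp
  have hmean : ∫ z : κ → ℝ, (∑ j, c j * z j + t) ∂(gaussianVector κ) = t := by
    rw [integral_add (hsum.integrable (by norm_num)) (integrable_const _),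
      integral_finsetSum _ fun j _ => (hL j).integrable (by norm_num)]
    simp [hint]
  have hvar : Var[fun z : κ → ℝ => ∑ j, c j * z j + t; gaussianVector κ] = ∑ j, c j ^ 2 := by
    rw [variance_add_const hsum.aestronglyMeasurable]
    have h := variance_sum_pi (μ := fun _ : κ => gaussianReal 0 1) (X := fun j x => c j * x)
      fun j => IsGaussian.memLp_two_id.const_mul _
    have h2 : (∑ j, fun z : κ → ℝ => c j * z j) = fun z => ∑ j, c j * z j := by
      ext z; simp
    rw [h2] at h
    rw [h]
    refine Finset.sum_congr rfl fun j _ => ?_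
    rw [variance_const_mul, variance_fun_id_gaussianReal]
    simp
  have h := variance_eq_sub hadd
  rw [hvar, hmean] at h
  have h' : ∫ z, (∑ j, c j * z j + t) ^ 2 ∂(gaussianVector κ)
    = (gaussianVector κ)[(fun z : κ → ℝ => ∑ j, c j * z j + t) ^ 2] := rfl
  rw [h']
  linarith

theorem lintegral_sum_mul_add_sq_gaussianMatrix (c : ι → κ → ℝ) (t : ℝ) :
    ∫⁻ z, ENNReal.ofReal ((∑ i, ∑ j, c i j * z i j + t) ^ 2) ∂(gaussianMatrix ι κ)
      = ENNReal.ofReal (∑ i, ∑ j, c i j ^ 2 + t ^ 2) := by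
  rw [← measurePreserving_curry_gaussianVector.lintegral_comp (by fun_prop)]
  obtain ⟨h1, h2⟩ := integral_sum_mul_add_sq_gaussianVector (fun a : ι × κ => c a.1 a.2) t
  simp only [Fintype.sum_prod_type] at h1 h2
  rw [← ofReal_integral_eq_lintegral_ofReal h1 (ae_of_all _ fun z => sq_nonneg _), h2]

/-- The reflection in the hyperplane orthogonal to `v - w` carries `v` to `w` because their norms
agree; as a linear isometry it preserves the Gaussian law. -/
theorem exists_orthogonal_mulVec_eq [DecidableEq κ] {v w : κ → ℝ} (h : v ⬝ᵥ v = w ⬝ᵥ w) :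
    ∃ O : Matrix κ κ ℝ, Oᵀ * O = 1 ∧ O *ᵥ v = w ∧
      MeasurePreserving (fun z => O *ᵥ z) (gaussianVector κ) (gaussianVector κ) := by
  have hnorm : ∀ u : κ → ℝ, ‖WithLp.toLp 2 u‖ ^ 2 = u ⬝ᵥ u := fun u => by
    rw [EuclideanSpace.real_norm_sq_eq]
    simp [dotProduct, sq]
  have hvw : ‖WithLp.toLp 2 v‖ = ‖WithLp.toLp 2 w‖ := by
    rw [← sq_eq_sq₀ (norm_nonneg _) (norm_nonneg _), hnorm, hnorm, h]
  set f := (ℝ ∙ (WithLp.toLp 2 v - WithLp.toLp 2 w))ᗮ.reflection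
  set O := Matrix.toEuclideanLin.symm
    (f.toLinearEquiv : EuclideanSpace ℝ κ →ₗ[ℝ] EuclideanSpace ℝ κ)
  have hO : ∀ u, O *ᵥ u = (f (WithLp.toLp 2 u)).ofLp := by
    intro u
    have h1 : Matrix.toEuclideanLin O
        = (f.toLinearEquiv : EuclideanSpace ℝ κ →ₗ[ℝ] EuclideanSpace ℝ κ) :=
      LinearEquiv.apply_symm_apply _ _
    have h2 := congrArg WithLp.ofLp (LinearMap.congr_fun h1 (WithLp.toLp 2 u))
    exact h2
  refine ⟨O, ?_, ?_, ?_⟩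
  · have hinner : ∀ a b, (O *ᵥ a) ⬝ᵥ (O *ᵥ b) = a ⬝ᵥ b := by
      intro a b
      have h1 := f.inner_map_map (WithLp.toLp 2 b) (WithLp.toLp 2 a)
      rw [EuclideanSpace.inner_eq_star_dotProduct, EuclideanSpace.inner_eq_star_dotProduct] at h1
      rw [hO, hO]
      simpa only [star_trivial] using h1
    ext i j
    have h1 := hinner (Pi.single i 1) (Pi.single j 1)
    simp only [Matrix.mulVec_single_one] at h1
    rw [Matrix.mul_apply]
    simpa [dotProduct, Matrix.one_apply, Pi.single_apply, eq_comm] using h1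
  · rw [hO, Submodule.reflection_sub hvw]
  · simp_rw [hO]
    exact measurePreserving_ofLp_stdGaussian.comp
      ((MeasurePreserving.mk (by fun_prop) (stdGaussian_map f)).comp
        measurePreserving_toLp_gaussianVector)

/-- Comparing `v` with the multiple of a basis vector of the same norm gives `h v = ‖v‖² h(e_j)` for
each `j`. Averaging over `j` is preferred because the sum over a basis becomes a trace in the
applications. -/
theorem eq_mul_sum_of_orthogonal_invariant [DecidableEq κ] [Nonempty κ] {h : (κ → ℝ) → ℝ≥0∞}
    (hsmul : ∀ (c : ℝ) v, h (c • v) = ENNReal.ofReal (c ^ 2) * h v)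
    (hinv : ∀ v w, v ⬝ᵥ v = w ⬝ᵥ w → h v = h w) (v : κ → ℝ) :
    h v = ENNReal.ofReal ((v ⬝ᵥ v) / Fintype.card κ) * ∑ j, h (Pi.single j 1) := by
  have hv : ∀ j, h v = ENNReal.ofReal (v ⬝ᵥ v) * h (Pi.single j 1) := by
    intro j
    have hnn : 0 ≤ v ⬝ᵥ v := by
      simpa [dotProduct] using Finset.sum_nonneg fun i _ => mul_self_nonneg (v i)
    rw [← Real.sq_sqrt hnn, ← hsmul]
    refine hinv _ _ ?_
    simp [← sq, Real.sq_sqrt hnn]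
  have hcard : (0 : ℝ) < Fintype.card κ := by exact_mod_cast Fintype.card_pos
  have hconst : ∀ j, ENNReal.ofReal ((v ⬝ᵥ v) / Fintype.card κ) * h (Pi.single j 1)
      = ENNReal.ofReal (1 / Fintype.card κ) * h v := by
    intro j
    rw [hv j, ← mul_assoc, ← ENNReal.ofReal_mul (by positivity)]
    congr 2
    ring
  rw [Finset.mul_sum, Finset.sum_congr rfl fun j _ => hconst j, Finset.sum_const, nsmul_eq_mul,
    ← mul_assoc, Finset.card_univ, ← ENNReal.ofReal_natCast, ← ENNReal.ofReal_mul hcard.le,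
    mul_one_div_cancel hcard.ne', ENNReal.ofReal_one, one_mul]

theorem ae_isUnit_det_gaussianMatrix [DecidableEq ι] (h : Fintype.card ι ≤ Fintype.card κ) :
    ∀ᵐ z ∂(gaussianMatrix ι κ), IsUnit (Matrix.of z * (Matrix.of z)ᵀ).det := by
  have h1 := measurePreserving_toLp_gaussianMatrix.quasiMeasurePreserving.ae
    (ae_linearIndependent_pi_stdGaussian (E := EuclideanSpace ℝ κ) (ι := ι) (by simpa using h))
  filter_upwards [h1] with z hz
  have h2 := Matrix.det_gram_ne_zero_iff_linearIndependent.2 hz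
  rw [← mul_transpose_eq_gram] at h2
  exact h2.isUnit

theorem lintegral_inv_mul_transpose_gaussianMatrix [DecidableEq ι]
    (h : Fintype.card ι ≤ Fintype.card κ) (i : ι) :
    ∫⁻ z, ENNReal.ofReal ((Matrix.of z * (Matrix.of z)ᵀ)⁻¹ i i) ∂(gaussianMatrix ι κ)
      = chiSqInvMoment (Fintype.card κ + 1 - Fintype.card ι) := by
  have h1 := lintegral_inv_gram_pi_stdGaussian (E := EuclideanSpace ℝ κ) (by simpa using h) i
  rw [finrank_euclideanSpace, ← measurePreserving_toLp_gaussianMatrix.lintegral_comp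
    (measurable_inv_gram_apply i i).ennreal_ofReal] at h1
  rw [← h1]
  simp_rw [← mul_transpose_eq_gram]

end GaussianMatrix

/-! ### Second moments of the pseudoinverse of a Gaussian matrix. -/

section GaussianPseudoinverse

variable {ι κ : Type*} [Fintype ι] [Fintype κ]

theorem measurePreserving_mul_left_gaussianMatrix [DecidableEq ι] {O : Matrix ι ι ℝ}
    (hO : MeasurePreserving (fun z => O *ᵥ z) (gaussianVector ι) (gaussianVector ι)) :
    MeasurePreserving (fun (z : ι → κ → ℝ) i j => (O * Matrix.of z) i j) (gaussianMatrix ι κ)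
      (gaussianMatrix ι κ) :=
  measurePreserving_swap_gaussianMatrix.comp
    ((measurePreserving_pi _ _ fun _ => hO).comp measurePreserving_swap_gaussianMatrix)

theorem measurePreserving_mul_transpose_gaussianMatrix [DecidableEq κ] {O : Matrix κ κ ℝ}
    (hO : MeasurePreserving (fun z => O *ᵥ z) (gaussianVector κ) (gaussianVector κ)) :
    MeasurePreserving (fun (z : ι → κ → ℝ) i j => (Matrix.of z * Oᵀ) i j) (gaussianMatrix ι κ)
      (gaussianMatrix ι κ) := by
  have h : (fun (z : ι → κ → ℝ) i j => (Matrix.of z * Oᵀ) i j) = fun z i => O *ᵥ z i := by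
    ext z i j
    simp [Matrix.mul_apply, Matrix.mulVec, dotProduct, mul_comm]
  rw [h]
  exact measurePreserving_pi _ _ fun _ => hO

theorem measurable_transpose_mul_inv [DecidableEq ι] (j : κ) (i : ι) :
    Measurable fun z : ι → κ → ℝ =>
      ((Matrix.of z)ᵀ * (Matrix.of z * (Matrix.of z)ᵀ)⁻¹) j i := by
  have hc : Continuous fun z : ι → κ → ℝ => Matrix.of z := continuous_id
  have hg : Continuous fun z : ι → κ → ℝ => Matrix.of z * (Matrix.of z)ᵀ :=
    hc.matrix_mul hc.matrix_transpose
  have h : (fun z : ι → κ → ℝ => ((Matrix.of z)ᵀ * (Matrix.of z * (Matrix.of z)ᵀ)⁻¹) j i)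
      = fun z => (Matrix.of z * (Matrix.of z)ᵀ).det⁻¹
          * ((Matrix.of z)ᵀ * (Matrix.of z * (Matrix.of z)ᵀ).adjugate) j i := by
    ext z
    rw [Matrix.inv_def, Ring.inverse_eq_inv', Matrix.mul_smul, Matrix.smul_apply, smul_eq_mul]
  rw [h]
  exact hg.matrix_det.measurable.inv.mul
    ((hc.matrix_transpose.matrix_mul hg.matrix_adjugate).matrix_elem j i).measurable

/-- As `pinv` is defined by choice, measurability is taken from `Aᵀ (A Aᵀ)⁻¹`, which it equals
almost surely when there are at most as many rows as columns; the other case follows by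
transposition. -/
theorem aemeasurable_pinv_gaussianMatrix (j : κ) (i : ι) :
    AEMeasurable (fun z : ι → κ → ℝ => pinv (Matrix.of z) j i) (gaussianMatrix ι κ) := by
  classical
  rcases le_total (Fintype.card ι) (Fintype.card κ) with h | h
  · refine ⟨_, measurable_transpose_mul_inv j i, ?_⟩
    filter_upwards [ae_isUnit_det_gaussianMatrix h] with z hz
    rw [pinv_eq (isMoorePenrose_of_isUnit_det hz)]
  · have h1 : AEMeasurable (fun z : κ → ι → ℝ => pinv (Matrix.of z) i j) (gaussianMatrix κ ι) := by
      refine ⟨_, measurable_transpose_mul_inv i j, ?_⟩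
      filter_upwards [ae_isUnit_det_gaussianMatrix h] with z hz
      rw [pinv_eq (isMoorePenrose_of_isUnit_det hz)]
    refine (h1.comp_quasiMeasurePreserving
      measurePreserving_swap_gaussianMatrix.quasiMeasurePreserving).congr
      (ae_of_all _ fun z => ?_)
    exact congrFun (congrFun (pinv_transpose (Matrix.of z)) i) j

theorem aemeasurable_sum_sq_pinv_gaussianMatrix :
    AEMeasurable (fun z : ι → κ → ℝ => ∑ j, ∑ i, pinv (Matrix.of z) j i ^ 2)
      (gaussianMatrix ι κ) :=
  Finset.aemeasurable_fun_sum _ fun j _ => Finset.aemeasurable_fun_sum _ fun i _ =>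
    (aemeasurable_pinv_gaussianMatrix j i).pow_const 2

theorem aemeasurable_pinv_mulVec_gaussianMatrix (v : ι → ℝ) (j : κ) :
    AEMeasurable (fun z : ι → κ → ℝ => (pinv (Matrix.of z) *ᵥ v) j) (gaussianMatrix ι κ) :=
  Finset.aemeasurable_fun_sum _ fun i _ => (aemeasurable_pinv_gaussianMatrix j i).mul_const _

theorem aemeasurable_one_sub_pinv_mul_gaussianMatrix [DecidableEq κ] (x : κ → ℝ) (j : κ) :
    AEMeasurable (fun z : ι → κ → ℝ => ((1 - pinv (Matrix.of z) * Matrix.of z) *ᵥ x) j)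
      (gaussianMatrix ι κ) := by
  refine Finset.aemeasurable_fun_sum _ fun k _ => AEMeasurable.mul_const ?_ _
  refine aemeasurable_const.sub (Finset.aemeasurable_fun_sum _ fun i _ => ?_)
  exact (aemeasurable_pinv_gaussianMatrix j i).mul
    (Measurable.aemeasurable (f := fun z : ι → κ → ℝ => z i k) (by fun_prop))

theorem aemeasurable_ofReal_dotProduct_self {T : Type*} [MeasurableSpace T] {τ : Measure T}
    {f : T → κ → ℝ} (hf : ∀ j, AEMeasurable (fun t => f t j) τ) :
    AEMeasurable (fun t => ENNReal.ofReal (f t ⬝ᵥ f t)) τ :=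
  (Finset.aemeasurable_fun_sum _ fun j _ => (hf j).mul (hf j)).ennreal_ofReal

/-- The expected squared Frobenius norm of the pseudoinverse of a Gaussian matrix. -/
noncomputable def pinvMoment (ι κ : Type*) [Fintype ι] [Fintype κ] : ℝ≥0∞ :=
  ∫⁻ z, ENNReal.ofReal (∑ j, ∑ i, pinv (Matrix.of z) j i ^ 2) ∂(gaussianMatrix ι κ)

theorem pinvMoment_comm : pinvMoment ι κ = pinvMoment κ ι := by
  have h : AEMeasurable (fun z : κ → ι → ℝ =>
      ENNReal.ofReal (∑ j, ∑ i, pinv (Matrix.of z) j i ^ 2)) (gaussianMatrix κ ι) :=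
    aemeasurable_sum_sq_pinv_gaussianMatrix.ennreal_ofReal
  have hmp := measurePreserving_swap_gaussianMatrix (ι := ι) (κ := κ)
  rw [pinvMoment, pinvMoment]
  conv_rhs => rw [← hmp.map_eq]
  rw [lintegral_map' (by rwa [hmp.map_eq]) hmp.aemeasurable]
  refine lintegral_congr fun z => ?_
  have h1 : pinv (Matrix.of fun j i => z i j) = (pinv (Matrix.of z))ᵀ :=
    pinv_transpose (Matrix.of z)
  rw [Finset.sum_comm, h1]
  rfl

/-- Almost surely the rows are independent, and the squared norm of column `i` of `A⁺` is then the
`i`-th diagonal entry of `(A Aᵀ)⁻¹`. -/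
theorem pinvMoment_of_card_le (h : Fintype.card ι ≤ Fintype.card κ) :
    pinvMoment ι κ = Fintype.card ι * chiSqInvMoment (Fintype.card κ + 1 - Fintype.card ι) := by
  classical
  have hi : ∀ i : ι, AEMeasurable (fun z : ι → κ → ℝ =>
      ENNReal.ofReal (∑ j, pinv (Matrix.of z) j i ^ 2)) (gaussianMatrix ι κ) := fun i =>
    (Finset.aemeasurable_fun_sum _ fun j _ =>
      (aemeasurable_pinv_gaussianMatrix j i).pow_const 2).ennreal_ofReal
  have hsum : pinvMoment ι κ = ∑ i, ∫⁻ z, ENNReal.ofReal (∑ j, pinv (Matrix.of z) j i ^ 2)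
      ∂(gaussianMatrix ι κ) := by
    rw [pinvMoment, ← lintegral_finsetSum' _ fun i _ => hi i]
    refine lintegral_congr fun z => ?_
    rw [Finset.sum_comm, ENNReal.ofReal_sum_of_nonneg fun i _ => by positivity]
  have hcol : ∀ i : ι, ∫⁻ z, ENNReal.ofReal (∑ j, pinv (Matrix.of z) j i ^ 2)
      ∂(gaussianMatrix ι κ) = chiSqInvMoment (Fintype.card κ + 1 - Fintype.card ι) := by
    intro i
    rw [← lintegral_inv_mul_transpose_gaussianMatrix h i]
    refine lintegral_congr_ae ?_
    filter_upwards [ae_isUnit_det_gaussianMatrix h] with z hz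
    rw [← transpose_pinv_mul_pinv_of_isUnit_det hz]
    simp [Matrix.mul_apply, sq]
  rw [hsum, Finset.sum_congr rfl fun i _ => hcol i]
  simp

theorem pinvMoment_eq_gammaFactor (hι : 1 ≤ Fintype.card ι) (hκ : 1 ≤ Fintype.card κ) :
    pinvMoment ι κ = gammaFactor (Fintype.card κ) (Fintype.card ι) := by
  -- Here `a` is the smaller dimension. The degrees of freedom `b + 1 - a` exceed `2` exactly when
  -- `a + 1 < b`, and `1 ≤ a` ensures `a * ∞ = ∞`.
  have aux : ∀ a b : ℕ, 1 ≤ a → a ≤ b → (a : ℝ≥0∞) * chiSqInvMoment (b + 1 - a)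
      = if a + 1 < b then ENNReal.ofReal ((a : ℝ) / ((b : ℝ) - a - 1)) else ∞ := by
    intro a b ha hab
    rw [chiSqInvMoment]
    by_cases h : a + 1 < b
    · rw [if_pos h, if_pos (by omega), ← ENNReal.ofReal_natCast,
        ← ENNReal.ofReal_mul (by positivity), Nat.cast_sub (by omega)]
      congr 1
      push_cast
      rw [mul_one_div]
      congr 1
      ring
    · rw [if_neg h, if_neg (by omega), ENNReal.mul_top]
      simpa using by omega
  rw [gammaFactor]
  rcases le_total (Fintype.card ι) (Fintype.card κ) with h | h
  · rw [pinvMoment_of_card_le h, aux _ _ hι h,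
      if_neg (show ¬ Fintype.card κ + 1 < Fintype.card ι by omega)]
  · rw [pinvMoment_comm, pinvMoment_of_card_le h, aux _ _ hκ h]
    split_ifs <;> first | rfl | omega

theorem smul_dotProduct_smul_self (c : ℝ) (v : κ → ℝ) :
    (c • v) ⬝ᵥ (c • v) = c ^ 2 * (v ⬝ᵥ v) := by
  simp only [smul_dotProduct, dotProduct_smul, smul_eq_mul]
  ring

theorem mulVec_dotProduct_mulVec_orthogonal [DecidableEq κ] {O : Matrix κ κ ℝ}
    (hO : Oᵀ * O = 1) (u : κ → ℝ) : (O *ᵥ u) ⬝ᵥ (O *ᵥ u) = u ⬝ᵥ u := by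
  rw [Matrix.dotProduct_mulVec, ← Matrix.mulVec_transpose, Matrix.mulVec_mulVec, hO,
    Matrix.one_mulVec]

theorem dotProduct_self_nonneg_real (v : κ → ℝ) : 0 ≤ v ⬝ᵥ v :=
  Finset.sum_nonneg fun i _ => mul_self_nonneg (v i)

/-- Replacing `A` by `O A` turns `A⁺` into `A⁺ Oᵀ`, so the integral depends on `v` only through its
norm; summing over the standard basis gives `‖A⁺‖_F²`. -/
theorem lintegral_pinv_mulVec_gaussianMatrix [Nonempty ι] (v : ι → ℝ) :
    ∫⁻ z, ENNReal.ofReal ((pinv (Matrix.of z) *ᵥ v) ⬝ᵥ (pinv (Matrix.of z) *ᵥ v))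
        ∂(gaussianMatrix ι κ)
      = ENNReal.ofReal ((v ⬝ᵥ v) / Fintype.card ι) * pinvMoment ι κ := by
  classical
  have hm : ∀ v : ι → ℝ, AEMeasurable (fun z : ι → κ → ℝ => ENNReal.ofReal
      ((pinv (Matrix.of z) *ᵥ v) ⬝ᵥ (pinv (Matrix.of z) *ᵥ v))) (gaussianMatrix ι κ) := fun v =>
    aemeasurable_ofReal_dotProduct_self (aemeasurable_pinv_mulVec_gaussianMatrix v)
  rw [eq_mul_sum_of_orthogonal_invariant (h := fun v => ∫⁻ z, ENNReal.ofReal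
    ((pinv (Matrix.of z) *ᵥ v) ⬝ᵥ (pinv (Matrix.of z) *ᵥ v)) ∂(gaussianMatrix ι κ)) _ _ v]
  · rw [← lintegral_finsetSum' _ fun i _ => hm _, pinvMoment]
    congr 1
    refine lintegral_congr fun z => ?_
    rw [sum_sq_eq_trace, ← sum_dotProduct_mulVec_single,
      ENNReal.ofReal_sum_of_nonneg fun i _ => dotProduct_self_nonneg_real _]
  · intro c v
    simp only [Matrix.mulVec_smul, smul_dotProduct_smul_self]
    simp_rw [ENNReal.ofReal_mul (sq_nonneg c)]
    rw [lintegral_const_mul' _ _ ENNReal.ofReal_ne_top]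
  · intro v w hvw
    obtain ⟨O, hO, rfl, hmp⟩ := exists_orthogonal_mulVec_eq hvw
    have hmp' := measurePreserving_mul_left_gaussianMatrix (κ := κ) hmp
    conv_rhs => rw [← hmp'.map_eq]
    rw [lintegral_map' (by rw [hmp'.map_eq]; exact hm _) hmp'.aemeasurable]
    refine lintegral_congr fun z => ?_
    have h1 : pinv (Matrix.of fun i j => (O * Matrix.of z) i j) = pinv (Matrix.of z) * Oᵀ := by
      have h2 := pinv_mul_transpose_orthogonal (Matrix.of z)ᵀ hO
      rw [← Matrix.transpose_mul, pinv_transpose, pinv_transpose] at h2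
      have h3 := congrArg Matrix.transpose h2
      rwa [Matrix.transpose_transpose, Matrix.transpose_mul, Matrix.transpose_transpose] at h3
    rw [h1, Matrix.mulVec_mulVec, Matrix.mul_assoc, hO, Matrix.mul_one]

/-- Full rank makes `A A⁺` or `A⁺ A` an identity matrix, and both have the same trace. -/
theorem ae_trace_pinv_mul_gaussianMatrix :
    ∀ᵐ z ∂(gaussianMatrix ι κ), (pinv (Matrix.of z) * Matrix.of z).trace
      = min (Fintype.card κ : ℝ) (Fintype.card ι) := by
  classical
  rcases le_total (Fintype.card ι) (Fintype.card κ) with h | h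
  · filter_upwards [ae_isUnit_det_gaussianMatrix h] with z hz
    rw [Matrix.trace_mul_comm, mul_pinv_of_isUnit_det hz, Matrix.trace_one,
      min_eq_right (by exact_mod_cast h)]
  · filter_upwards [(measurePreserving_swap_gaussianMatrix (ι := ι) (κ := κ)).quasiMeasurePreserving.ae
      (ae_isUnit_det_gaussianMatrix h)] with z hz
    have h1 := mul_pinv_of_isUnit_det hz
    have h2 : (Matrix.of fun j i => z i j) = (Matrix.of z)ᵀ := rfl
    rw [h2, pinv_transpose, ← Matrix.transpose_mul] at h1
    rw [← Matrix.trace_transpose, h1, Matrix.trace_one, min_eq_left (by exact_mod_cast h)]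

/-- Replacing `A` by `A Oᵀ` conjugates the projection `1 - A⁺A` by `O`, so only the norm of `x`
matters; the basis sum is the trace of the projection, almost surely constant. -/
theorem lintegral_one_sub_pinv_mul_gaussianMatrix [DecidableEq κ] [Nonempty κ] (x : κ → ℝ) :
    ∫⁻ z, ENNReal.ofReal (((1 - pinv (Matrix.of z) * Matrix.of z) *ᵥ x)
        ⬝ᵥ ((1 - pinv (Matrix.of z) * Matrix.of z) *ᵥ x)) ∂(gaussianMatrix ι κ)
      = ENNReal.ofReal ((x ⬝ᵥ x)
        * (1 - min (Fintype.card κ : ℝ) (Fintype.card ι) / Fintype.card κ)) := by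
  have hm : ∀ x : κ → ℝ, AEMeasurable (fun z : ι → κ → ℝ => ENNReal.ofReal
      (((1 - pinv (Matrix.of z) * Matrix.of z) *ᵥ x)
        ⬝ᵥ ((1 - pinv (Matrix.of z) * Matrix.of z) *ᵥ x))) (gaussianMatrix ι κ) := fun x =>
    aemeasurable_ofReal_dotProduct_self (aemeasurable_one_sub_pinv_mul_gaussianMatrix x)
  rw [eq_mul_sum_of_orthogonal_invariant (h := fun x => ∫⁻ z, ENNReal.ofReal
    (((1 - pinv (Matrix.of z) * Matrix.of z) *ᵥ x)
      ⬝ᵥ ((1 - pinv (Matrix.of z) * Matrix.of z) *ᵥ x)) ∂(gaussianMatrix ι κ)) _ _ x]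
  · rw [← lintegral_finsetSum' _ fun i _ => hm _]
    have hcard : (0 : ℝ) < Fintype.card κ := by exact_mod_cast Fintype.card_pos
    have h1 : ∀ᵐ z ∂(gaussianMatrix ι κ), ∑ j, ENNReal.ofReal
        (((1 - pinv (Matrix.of z) * Matrix.of z) *ᵥ Pi.single j 1)
          ⬝ᵥ ((1 - pinv (Matrix.of z) * Matrix.of z) *ᵥ Pi.single j 1))
        = ENNReal.ofReal (Fintype.card κ - min (Fintype.card κ : ℝ) (Fintype.card ι)) := by
      filter_upwards [ae_trace_pinv_mul_gaussianMatrix (ι := ι) (κ := κ)] with z hz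
      rw [← ENNReal.ofReal_sum_of_nonneg fun i _ => dotProduct_self_nonneg_real _,
        sum_dotProduct_mulVec_single, trace_transpose_mul_one_sub_pinv_mul, hz]
    rw [lintegral_congr_ae h1, lintegral_const, measure_univ, mul_one, ← ENNReal.ofReal_mul
      (div_nonneg (dotProduct_self_nonneg_real x) hcard.le)]
    congr 1
    field_simp
  · intro c v
    simp only [Matrix.mulVec_smul, smul_dotProduct_smul_self]
    simp_rw [ENNReal.ofReal_mul (sq_nonneg c)]
    rw [lintegral_const_mul' _ _ ENNReal.ofReal_ne_top]
  · intro v w hvw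
    obtain ⟨O, hO, rfl, hmp⟩ := exists_orthogonal_mulVec_eq hvw
    have hmp' := measurePreserving_mul_transpose_gaussianMatrix (ι := ι) hmp
    conv_rhs => rw [← hmp'.map_eq]
    rw [lintegral_map' (by rw [hmp'.map_eq]; exact hm _) hmp'.aemeasurable]
    refine lintegral_congr fun z => ?_
    have h0 : (Matrix.of fun i j => (Matrix.of z * Oᵀ) i j) = Matrix.of z * Oᵀ := rfl
    have h1 : (1 - O * pinv (Matrix.of z) * (Matrix.of z * Oᵀ)) *ᵥ (O *ᵥ v)
        = O *ᵥ ((1 - pinv (Matrix.of z) * Matrix.of z) *ᵥ v) := by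
      rw [Matrix.mulVec_mulVec, Matrix.mulVec_mulVec]
      congr 1
      rw [Matrix.sub_mul, Matrix.mul_sub, Matrix.one_mul, Matrix.mul_one, Matrix.mul_assoc,
        Matrix.mul_assoc, Matrix.mul_assoc, hO, Matrix.mul_one]
    rw [h0, pinv_mul_transpose_orthogonal _ hO, h1, mulVec_dotProduct_mulVec_orthogonal hO]

/-- Coordinate `k` of the vector is affine in the entries of `B`, with mean `u k` and variance `‖b‖²
∑ i, W k i ^ 2`. -/
theorem lintegral_sub_mulVec_gaussianMatrix {γ : Type*} [Fintype γ] (W : Matrix κ ι ℝ) (u : κ → ℝ)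
    (b : γ → ℝ) :
    ∫⁻ B, ENNReal.ofReal ((u - W *ᵥ (Matrix.of B *ᵥ b)) ⬝ᵥ (u - W *ᵥ (Matrix.of B *ᵥ b)))
        ∂(gaussianMatrix ι γ)
      = ENNReal.ofReal (u ⬝ᵥ u + (b ⬝ᵥ b) * ∑ k, ∑ i, W k i ^ 2) := by
  have h1 : ∀ B : ι → γ → ℝ, ENNReal.ofReal
      ((u - W *ᵥ (Matrix.of B *ᵥ b)) ⬝ᵥ (u - W *ᵥ (Matrix.of B *ᵥ b)))
      = ∑ k, ENNReal.ofReal ((∑ i, ∑ j, (-(W k i * b j)) * B i j + u k) ^ 2) := by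
    intro B
    rw [← ENNReal.ofReal_sum_of_nonneg fun k _ => sq_nonneg _]
    congr 1
    refine Finset.sum_congr rfl fun k _ => ?_
    rw [← sq]
    congr 1
    simp only [Pi.sub_apply, Matrix.mulVec, dotProduct, Matrix.of_apply, Finset.mul_sum]
    rw [add_comm, sub_eq_add_neg, ← Finset.sum_neg_distrib]
    congr 1
    refine Finset.sum_congr rfl fun i _ => ?_
    rw [← Finset.sum_neg_distrib]
    exact Finset.sum_congr rfl fun j _ => by ring
  simp_rw [h1]
  rw [lintegral_finsetSum _ fun k _ => by fun_prop]
  simp_rw [lintegral_sum_mul_add_sq_gaussianMatrix]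
  rw [← ENNReal.ofReal_sum_of_nonneg fun k _ => by positivity]
  congr 1
  rw [Finset.sum_add_distrib, add_comm]
  congr 1
  · simp [dotProduct, sq]
  · rw [Finset.mul_sum]
    refine Finset.sum_congr rfl fun k _ => ?_
    rw [Finset.mul_sum]
    refine Finset.sum_congr rfl fun i _ => ?_
    rw [dotProduct, Finset.sum_mul]
    exact Finset.sum_congr rfl fun j _ => by ring

end GaussianPseudoinverse

/-! ### From the error decomposition to the expected MSE. -/

section ExpectedError

variable {ι κ : Type*} [Fintype ι] [Fintype κ]

/-- The squared error of the estimate `A⁺ (A x + B c + v)` of `x`. -/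
noncomputable def sqError {γ : Type*} [Fintype γ] [DecidableEq κ] (A : ι → κ → ℝ)
    (B : ι → γ → ℝ) (x : κ → ℝ) (c : γ → ℝ) (v : ι → ℝ) : ℝ :=
  let e := (1 - pinv (Matrix.of A) * Matrix.of A) *ᵥ x - pinv (Matrix.of A) *ᵥ v
    - pinv (Matrix.of A) *ᵥ (Matrix.of B *ᵥ c)
  e ⬝ᵥ e

theorem aemeasurable_sqError {γ T : Type*} [Fintype γ] [DecidableEq κ] [MeasurableSpace T]
    {τ : Measure T} {A : T → ι → κ → ℝ} {B : T → ι → γ → ℝ} {x : T → κ → ℝ} {c : T → γ → ℝ}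
    {v : T → ι → ℝ} (hp : ∀ j i, AEMeasurable (fun t => pinv (Matrix.of (A t)) j i) τ)
    (hA : AEMeasurable A τ) (hB : AEMeasurable B τ) (hx : AEMeasurable x τ)
    (hc : AEMeasurable c τ) (hv : AEMeasurable v τ) :
    AEMeasurable (fun t => ENNReal.ofReal (sqError (A t) (B t) (x t) (c t) (v t))) τ := by
  have hA' : ∀ i j, AEMeasurable (fun t => A t i j) τ := fun i j =>
    aemeasurable_pi_iff.1 (aemeasurable_pi_iff.1 hA i) j
  have hB' : ∀ i j, AEMeasurable (fun t => B t i j) τ := fun i j =>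
    aemeasurable_pi_iff.1 (aemeasurable_pi_iff.1 hB i) j
  have hx' := aemeasurable_pi_iff.1 hx
  have hc' := aemeasurable_pi_iff.1 hc
  have hv' := aemeasurable_pi_iff.1 hv
  refine aemeasurable_ofReal_dotProduct_self (f := fun t =>
    (1 - pinv (Matrix.of (A t)) * Matrix.of (A t)) *ᵥ (x t) - pinv (Matrix.of (A t)) *ᵥ (v t)
    - pinv (Matrix.of (A t)) *ᵥ (Matrix.of (B t) *ᵥ (c t))) fun j => ?_
  refine (AEMeasurable.sub ?_ ?_).sub ?_
  · exact Finset.aemeasurable_fun_sum _ fun k _ => AEMeasurable.mul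
      (aemeasurable_const.sub (Finset.aemeasurable_fun_sum _ fun i _ => (hp j i).mul (hA' i k)))
      (hx' k)
  · exact Finset.aemeasurable_fun_sum _ fun i _ => (hp j i).mul (hv' i)
  · exact Finset.aemeasurable_fun_sum _ fun i _ => (hp j i).mul
      (Finset.aemeasurable_fun_sum _ fun k _ => (hB' i k).mul (hc' k))

/-- The inner integral is over the second block with the first fixed, which removes its cross terms;
the remaining cross term, between `(1 - A⁺A) x` and `A⁺ v`, is zero for every `A`. -/
theorem lintegral_sqError_gaussianMatrix {γ : Type*} [Fintype γ] [DecidableEq κ] [Nonempty ι]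
    [Nonempty κ] (x : κ → ℝ) (c : γ → ℝ) (v : ι → ℝ) :
    ∫⁻ Z, ENNReal.ofReal (sqError Z.1 Z.2 x c v) ∂((gaussianMatrix ι κ).prod (gaussianMatrix ι γ))
      = ENNReal.ofReal ((x ⬝ᵥ x)
          * (1 - min (Fintype.card κ : ℝ) (Fintype.card ι) / Fintype.card κ))
        + ENNReal.ofReal (c ⬝ᵥ c + (v ⬝ᵥ v) / Fintype.card ι) * pinvMoment ι κ := by
  have hm : AEMeasurable (fun Z : (ι → κ → ℝ) × (ι → γ → ℝ) =>
      ENNReal.ofReal (sqError Z.1 Z.2 x c v))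
      ((gaussianMatrix ι κ).prod (gaussianMatrix ι γ)) :=
    aemeasurable_sqError (fun j i => (aemeasurable_pinv_gaussianMatrix j i).comp_fst)
      measurable_fst.aemeasurable measurable_snd.aemeasurable aemeasurable_const
      aemeasurable_const aemeasurable_const
  rw [lintegral_prod _ hm]
  have h1 : ∀ A : ι → κ → ℝ, ∫⁻ B, ENNReal.ofReal (sqError A B x c v) ∂(gaussianMatrix ι γ)
      = ENNReal.ofReal (((1 - pinv (Matrix.of A) * Matrix.of A) *ᵥ x)
          ⬝ᵥ ((1 - pinv (Matrix.of A) * Matrix.of A) *ᵥ x))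
        + (ENNReal.ofReal ((pinv (Matrix.of A) *ᵥ v) ⬝ᵥ (pinv (Matrix.of A) *ᵥ v))
          + ENNReal.ofReal (c ⬝ᵥ c)
            * ENNReal.ofReal (∑ j, ∑ i, pinv (Matrix.of A) j i ^ 2)) := by
    intro A
    have h2 := dotProduct_pinv_orthogonal (Matrix.of A) x v
    have h3 := h2
    rw [dotProduct_comm] at h3
    unfold sqError
    dsimp only
    rw [lintegral_sub_mulVec_gaussianMatrix, ← ENNReal.ofReal_mul (dotProduct_self_nonneg_real _),
      ← ENNReal.ofReal_add (dotProduct_self_nonneg_real _)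
        (mul_nonneg (dotProduct_self_nonneg_real _) (by positivity)),
      ← ENNReal.ofReal_add (dotProduct_self_nonneg_real _) (add_nonneg
        (dotProduct_self_nonneg_real _)
        (mul_nonneg (dotProduct_self_nonneg_real _) (by positivity)))]
    congr 1
    rw [sub_dotProduct, dotProduct_sub, dotProduct_sub, h2, h3]
    ring
  simp_rw [h1]
  rw [lintegral_add_left' (aemeasurable_ofReal_dotProduct_self
      (aemeasurable_one_sub_pinv_mul_gaussianMatrix x)),
    lintegral_add_left' (aemeasurable_ofReal_dotProduct_self
      (aemeasurable_pinv_mulVec_gaussianMatrix v)),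
    lintegral_one_sub_pinv_mul_gaussianMatrix, lintegral_pinv_mulVec_gaussianMatrix,
    lintegral_const_mul' _ _ ENNReal.ofReal_ne_top, ENNReal.ofReal_add
      (dotProduct_self_nonneg_real _)
      (div_nonneg (dotProduct_self_nonneg_real _) (Nat.cast_nonneg _)), add_mul, pinvMoment,
    add_comm (ENNReal.ofReal (c ⬝ᵥ c) * _)]

section SecondMoments

variable {Ω : Type*} [MeasurableSpace Ω] {P : Measure Ω}

theorem memLp_coord {x : Ω → EuclideanSpace ℝ κ} {q : ℝ≥0∞} (hx : MemLp x q P) (j : κ) :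
    MemLp (fun ω => x ω j) q P :=
  (EuclideanSpace.proj (𝕜 := ℝ) j).comp_memLp' hx

theorem integral_coord {x : Ω → EuclideanSpace ℝ κ} (hx : Integrable x P)
    (hx0 : ∫ ω, x ω ∂P = 0) (j : κ) : ∫ ω, x ω j ∂P = 0 := by
  have h := (EuclideanSpace.proj (𝕜 := ℝ) j).integral_comp_comm hx
  rw [hx0, map_zero] at h
  exact h

theorem integral_dotProduct_self_eq_trace [IsProbabilityMeasure P] {x : Ω → EuclideanSpace ℝ κ}
    (hx : ∀ j, MemLp (fun ω => x ω j) 2 P) (hx0 : ∀ j, ∫ ω, x ω j ∂P = 0) :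
    Integrable (fun ω => (x ω).ofLp ⬝ᵥ (x ω).ofLp) P ∧
      ∫ ω, (x ω).ofLp ⬝ᵥ (x ω).ofLp ∂P = (covarianceMatrix x x P).trace := by
  have hint : ∀ j, Integrable (fun ω => x ω j * x ω j) P := fun j => (hx j).integrable_mul (hx j)
  refine ⟨integrable_finsetSum _ fun j _ => hint j, ?_⟩
  simp only [dotProduct]
  rw [integral_finsetSum _ fun j _ => hint j]
  refine Finset.sum_congr rfl fun j _ => ?_
  rw [Matrix.diag_apply, covarianceMatrix, Matrix.of_apply, covariance_eq_sub (hx j) (hx j), hx0]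
  simp [Pi.mul_apply]

end SecondMoments

variable {n p : ℕ}

theorem norm_sub_sq_eq_sqError (S : Finset (Fin p)) (a : Fin n → Fin p → ℝ)
    (x : EuclideanSpace ℝ (Fin p)) (v : EuclideanSpace ℝ (Fin n)) :
    ‖subvector x S - WithLp.toLp 2
        (pinv (colSubmatrix (Matrix.of a) S) *ᵥ (output (Matrix.of a) x v).ofLp)‖ ^ 2
      = sqError (fun i (j : S) => a i j) (fun i (j : (Sᶜ : Finset (Fin p))) => a i j)
          (subvector x S).ofLp (subvector x Sᶜ).ofLp v.ofLp := by
  have hcol : colSubmatrix (Matrix.of a) S = Matrix.of fun i (j : S) => a i j := rfl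
  have hsplit : Matrix.of a *ᵥ x.ofLp
      = (Matrix.of fun i (j : S) => a i j) *ᵥ (subvector x S).ofLp
        + (Matrix.of fun i (j : (Sᶜ : Finset (Fin p))) => a i j) *ᵥ (subvector x Sᶜ).ofLp := by
    ext i
    simp only [Matrix.mulVec, dotProduct, Matrix.of_apply, Pi.add_apply, subvector]
    rw [← Finset.sum_add_sum_compl S, Finset.sum_coe_sort S fun j => a i j * x j,
      Finset.sum_coe_sort Sᶜ fun j => a i j * x j]
  have herr : (subvector x S).ofLp
      - pinv (colSubmatrix (Matrix.of a) S) *ᵥ (output (Matrix.of a) x v).ofLp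
      = (1 - pinv (Matrix.of fun i (j : S) => a i j) * Matrix.of fun i (j : S) => a i j)
          *ᵥ (subvector x S).ofLp
        - pinv (Matrix.of fun i (j : S) => a i j) *ᵥ v.ofLp
        - pinv (Matrix.of fun i (j : S) => a i j)
          *ᵥ ((Matrix.of fun i (j : (Sᶜ : Finset (Fin p))) => a i j) *ᵥ (subvector x Sᶜ).ofLp) := by
    simp only [output]
    rw [hcol, hsplit, Matrix.mulVec_add, Matrix.mulVec_add, Matrix.sub_mulVec, Matrix.one_mulVec,
      ← Matrix.mulVec_mulVec]
    abel
  rw [sqError, ← herr, EuclideanSpace.real_norm_sq_eq]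
  simp [dotProduct, sq]

section Regressors

variable {Ω' : Type*} [MeasurableSpace Ω'] {Q : Measure Ω'} [IsProbabilityMeasure Q]
  {a : Fin n → Ω' → EuclideanSpace ℝ (Fin p)}

theorem hasLaw_gaussianMatrix (ha_indep : iIndepFun a Q)
    (ha_law : ∀ i, HasLaw (a i) (multivariateGaussian 0 (1 : Matrix (Fin p) (Fin p) ℝ)) Q) :
    HasLaw (fun ω i j => a i ω j) (gaussianMatrix (Fin n) (Fin p)) Q := by
  have hm : AEMeasurable (fun ω i => a i ω) Q :=
    aemeasurable_pi_iff.2 fun i => (ha_law i).aemeasurable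
  have h1 : MeasurePreserving (fun (w : Fin n → EuclideanSpace ℝ (Fin p)) i => (w i).ofLp)
      (Measure.pi fun _ => stdGaussian (EuclideanSpace ℝ (Fin p)))
      (gaussianMatrix (Fin n) (Fin p)) :=
    measurePreserving_pi _ _ fun _ => measurePreserving_ofLp_stdGaussian
  refine ⟨h1.measurable.comp_aemeasurable hm, ?_⟩
  have h2 := (iIndepFun_iff_map_fun_eq_pi_map fun i => (ha_law i).aemeasurable).1 ha_indep
  simp only [fun i => (ha_law i).map_eq, multivariateGaussian_zero_one] at h2
  rw [← h1.map_eq, ← h2, AEMeasurable.map_map_of_aemeasurable h1.measurable.aemeasurable hm]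
  rfl

end Regressors

/-- The expected MSE of the pseudoinverse estimator. The covariance of `x` and `v` does not enter:
it multiplies an entry of `A_C`, which is centered given `A_S`. -/
theorem expectedMSE_eq {Ω Ω' : Type*} [MeasurableSpace Ω] [MeasurableSpace Ω']
    (P : Measure Ω) [IsProbabilityMeasure P] (Q : Measure Ω') [IsProbabilityMeasure Q]
    (hn : 1 ≤ n) (S : Finset (Fin p)) (hS : S.Nonempty)
    (x : Ω → EuclideanSpace ℝ (Fin p)) (v : Ω → EuclideanSpace ℝ (Fin n))
    (hx : MemLp x 2 P) (hv : MemLp v 2 P)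
    (hx0 : ∫ ω, x ω ∂P = 0) (hv0 : ∫ ω, v ω ∂P = 0)
    (a : Fin n → Ω' → EuclideanSpace ℝ (Fin p))
    (ha_indep : iIndepFun a Q)
    (ha_law : ∀ i, HasLaw (a i) (multivariateGaussian 0 (1 : Matrix (Fin p) (Fin p) ℝ)) Q) :
    expectedMSE P Q x v a S (1 : Matrix S S ℝ) (0 : Matrix (Fin n) (Fin n) ℝ)
      = ENNReal.ofReal
          ((covarianceMatrix (fun ω => subvector (x ω) S) (fun ω => subvector (x ω) S) P).trace
            * (1 - (min S.card n : ℝ) / (S.card : ℝ)))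
        + gammaFactor S.card n * ENNReal.ofReal
          ((covarianceMatrix (fun ω => subvector (x ω) Sᶜ) (fun ω => subvector (x ω) Sᶜ) P).trace
            + (covarianceMatrix v v P).trace / (n : ℝ)) := by
  have : Nonempty S := hS.to_subtype
  have : NeZero n := ⟨by omega⟩
  have hxm : AEMeasurable (fun ω => (x ω).ofLp) P :=
    (WithLp.measurable_ofLp 2 _).comp_aemeasurable hx.aestronglyMeasurable.aemeasurable
  have hvm : AEMeasurable (fun ω => (v ω).ofLp) P :=
    (WithLp.measurable_ofLp 2 _).comp_aemeasurable hv.aestronglyMeasurable.aemeasurable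
  have hsub : ∀ T : Finset (Fin p), AEMeasurable (fun ω => (subvector (x ω) T).ofLp) P := fun T =>
    aemeasurable_pi_iff.2 fun j => aemeasurable_pi_iff.1 hxm j
  set μ := (gaussianMatrix (Fin n) S).prod (gaussianMatrix (Fin n) (Sᶜ : Finset (Fin p))) with hμ
  -- The regressors enter only through the joint law of their two column blocks, so the expectation
  -- moves to the canonical product `μ`.
  have hlaw : HasLaw (fun ω => ((fun i (j : S) => a i ω j),
      (fun i (j : (Sᶜ : Finset (Fin p))) => a i ω j))) μ Q := by
    have h1 := hasLaw_gaussianMatrix ha_indep ha_law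
    have h2 := measurePreserving_columns_gaussianMatrix (ι := Fin n) S
    refine ⟨h2.measurable.comp_aemeasurable h1.aemeasurable, ?_⟩
    rw [hμ, ← h2.map_eq, ← h1.map_eq, AEMeasurable.map_map_of_aemeasurable
      h2.measurable.aemeasurable h1.aemeasurable]
    rfl
  have hjoint : AEMeasurable (fun t : ((Fin n → S → ℝ) × (Fin n → (Sᶜ : Finset (Fin p)) → ℝ)) × Ω =>
      ENNReal.ofReal (sqError t.1.1 t.1.2 (subvector (x t.2) S).ofLp (subvector (x t.2) Sᶜ).ofLp
        (v t.2).ofLp)) (μ.prod P) :=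
    aemeasurable_sqError
      (fun j i => ((aemeasurable_pinv_gaussianMatrix j i).comp_fst (ν := _)).comp_fst)
      (by fun_prop) (by fun_prop) (hsub S).comp_snd (hsub Sᶜ).comp_snd hvm.comp_snd
  have h1 : expectedMSE P Q x v a S (1 : Matrix S S ℝ) (0 : Matrix (Fin n) (Fin n) ℝ)
      = ∫⁻ Z, ∫⁻ ω, ENNReal.ofReal (sqError Z.1 Z.2 (subvector (x ω) S).ofLp
          (subvector (x ω) Sᶜ).ofLp (v ω).ofLp) ∂P ∂μ := by
    rw [← hlaw.map_eq, lintegral_map' (by rw [hlaw.map_eq]; exact hjoint.lintegral_prod_right')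
      hlaw.aemeasurable]
    refine lintegral_congr fun ω' => lintegral_congr fun ω => ?_
    rw [partialLMMSE_one_zero, rowMatrix, norm_sub_sq_eq_sqError]
  have hcoord : ∀ T : Finset (Fin p),
      Integrable (fun ω => (subvector (x ω) T).ofLp ⬝ᵥ (subvector (x ω) T).ofLp) P ∧
        ∫ ω, (subvector (x ω) T).ofLp ⬝ᵥ (subvector (x ω) T).ofLp ∂P
          = (covarianceMatrix (fun ω => subvector (x ω) T) (fun ω => subvector (x ω) T) P).trace :=
    fun T => integral_dotProduct_self_eq_trace (fun j => memLp_coord hx j)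
      (fun j => integral_coord (hx.integrable (by norm_num)) hx0 j)
  have hvcoord := integral_dotProduct_self_eq_trace (fun j => memLp_coord hv j)
      (fun j => integral_coord (hv.integrable (by norm_num)) hv0 j)
  have hcard : 0 < (S.card : ℝ) := by exact_mod_cast hS.card_pos
  have hnn : 0 ≤ 1 - (min S.card n : ℝ) / (S.card : ℝ) := by
    rw [sub_nonneg, div_le_one hcard]
    exact min_le_left _ _
  -- After the exchange the regressors are averaged with `x` and `v` fixed; only squared norms of
  -- `x_S`, `x_C` and `v` survive, and their means are the covariance traces.
  rw [h1, lintegral_lintegral_swap hjoint]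
  simp_rw [hμ, lintegral_sqError_gaussianMatrix, Fintype.card_coe, Fintype.card_fin]
  rw [pinvMoment_eq_gammaFactor (by simpa using hn) (by simpa using hS.card_pos),
    Fintype.card_coe, Fintype.card_fin]
  have hi1 := (hcoord S).1.mul_const (1 - (min S.card n : ℝ) / (S.card : ℝ))
  have hi2 : Integrable (fun ω => (subvector (x ω) Sᶜ).ofLp ⬝ᵥ (subvector (x ω) Sᶜ).ofLp
      + (v ω).ofLp ⬝ᵥ (v ω).ofLp / (n : ℝ)) P := (hcoord Sᶜ).1.add (hvcoord.1.div_const (n : ℝ))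
  rw [lintegral_add_left' hi1.aemeasurable.ennreal_ofReal, lintegral_mul_const'' _
      hi2.aemeasurable.ennreal_ofReal, mul_comm (gammaFactor _ _),
    ← ofReal_integral_eq_lintegral_ofReal hi1
      (ae_of_all _ fun ω => mul_nonneg (dotProduct_self_nonneg_real _) hnn),
    ← ofReal_integral_eq_lintegral_ofReal hi2
      (ae_of_all _ fun ω => add_nonneg (dotProduct_self_nonneg_real _)
        (div_nonneg (dotProduct_self_nonneg_real _) (Nat.cast_nonneg _)))]
  rw [integral_mul_const, integral_add (hcoord Sᶜ).1 (hvcoord.1.div_const (n : ℝ)),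
    integral_div, (hcoord S).2, (hcoord Sᶜ).2, hvcoord.2]

end ExpectedError

end MismatchedLMMSE

theorem theorem1 {Ω Ω' : Type*} [MeasurableSpace Ω] [MeasurableSpace Ω']
    (P : Measure Ω) [IsProbabilityMeasure P] (Q : Measure Ω') [IsProbabilityMeasure Q]
    {n p : ℕ} (hn : 1 ≤ n) (S : Finset (Fin p)) (hS : S.Nonempty)
    -- the unknowns and the noise: square integrable, zero-mean, uncorrelated
    (x : Ω → EuclideanSpace ℝ (Fin p)) (v : Ω → EuclideanSpace ℝ (Fin n))
    (hx : MemLp x 2 P) (hv : MemLp v 2 P)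
    (hx0 : ∫ ω, x ω ∂P = 0) (hv0 : ∫ ω, v ω ∂P = 0)
    (hxv : covarianceMatrix x v P = 0)
    -- the regressors: i.i.d. standard Gaussian rows
    (a : Fin n → Ω' → EuclideanSpace ℝ (Fin p))
    (ha_indep : iIndepFun a Q)
    (ha_law : ∀ i, HasLaw (a i) (multivariateGaussian 0 (1 : Matrix (Fin p) (Fin p) ℝ)) Q) :
    (∀ A : Matrix (Fin n) (Fin p) ℝ,
      partialLMMSE S (1 : Matrix S S ℝ) (0 : Matrix (Fin n) (Fin n) ℝ) A
        = pinv (colSubmatrix A S)) ∧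
    expectedMSE P Q x v a S (1 : Matrix S S ℝ) (0 : Matrix (Fin n) (Fin n) ℝ)
      = ENNReal.ofReal
          ((covarianceMatrix (fun ω => subvector (x ω) S) (fun ω => subvector (x ω) S) P).trace
            * (1 - (min S.card n : ℝ) / (S.card : ℝ)))
        + gammaFactor S.card n * ENNReal.ofReal
          ((covarianceMatrix (fun ω => subvector (x ω) Sᶜ) (fun ω => subvector (x ω) Sᶜ) P).trace
            + (covarianceMatrix v v P).trace / (n : ℝ)) := by
  exact ⟨partialLMMSE_one_zero S,
    expectedMSE_eq P Q hn S hS x v hx hv hx0 hv0 a ha_indep ha_law⟩
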